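/- Let $\Bbbk$ be a field of characteristic $0$ and let $n\ge 3$. Let $\mathcal{FK}_n$ be the Fomin–Kirillov algebra, i.e. the $\Bbbk$-algebra presented by generators $x_{(ij)}$, $1\le i<j\le n$, and relations $$x_{(ij)}^2=0\ (i<j),\qquad x_{(ij)}x_{(jk)}=x_{(jk)}x_{(ik)}+x_{(ik)}x_{(ij)},\qquad x_{(jk)}x_{(ij)}=x_{(ik)}x_{(jk)}+x_{(ij)}x_{(ik)}\ (i<j<k),$$ $$x_{(ij)}x_{(kl)}=x_{(kl)}x_{(ij)}\ (i<j,\ k<l,\ \#\{i,j,k,l\}=4).$$ It is a graded bialgebra in the category of Yetter–Drinfeld modules over $\Bbbk S_n$: each $x_{(ij)}$ has degree $1$ for the $\mathbb{Z}_{\ge 0}$-grading, has coaction degree the transposition $(ij)$, and is primitive; $g\in S_n$ acts by $g\cdot x_{(ij)}=x_{(g(i)\,g(j))}$ with the convention $x_{(ji)}=-x_{(ij)}$. Then $\mathcal{FK}_n$ admits no nontrivial graded deformations, both as a graded bialgebra in the category of Yetter–Drinfeld modules over $\Bbbk S_n$ and as a braided bialgebra. That is, give $\mathcal{FK}_n[t]=\mathcal{FK}_n\otimes\Bbbk[t]$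 the grading with $\deg t=1$ and the $\Bbbk[t]$-linear extension of the Yetter–Drinfeld structure and of the braiding of $\mathcal{FK}_n$. Let $(m_t,\Delta_t)$ be a $\Bbbk[t]$-linear graded bialgebra structure on $\mathcal{FK}_n[t]$ with respect to this braiding (with some graded unit and counit) that specializes at $t=0$ to the multiplication and comultiplication of $\mathcal{FK}_n$, and whose structure maps are morphisms of Yetter–Drinfeld modules (respectively, commute with the braiding). Then there is a $\Bbbk[t]$-linear graded bialgebra isomorphism from $(\mathcal{FK}_n[t],m_t,\Delta_t)$ to $\mathcal{FK}_n[t]$ with the $\Bbbk[t]$-linearly extended structure of $\mathcal{FK}_n$, which is a morphism of Yetter–Drinfeld modules (respectively, commutes with the braiding) and is the identity modulo $t$. -/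

import Mathlib

open scoped TensorProduct

noncomputable section

/-! ## Yetter-Drinfeld modules over the group algebra of a finite group -/

/-- A Yetter-Drinfeld module over the group algebra `R[G]` of a finite group `G`, on the
`R`-module `M`: an `R`-linear action of `G` together with a `G`-grading, the latter given by the
projections `proj g` of `M` onto its homogeneous components `M_g`, such that `g · M_h ⊆ M_{ghg⁻¹}`. -/
structure YetterDrinfeld (R G M : Type*) [CommRing R] [Group G] [Fintype G]
    [AddCommGroup M] [Module R M] where
  act : Representation R G M
  proj : G → M →ₗ[R] M
  proj_self : ∀ g, proj g ∘ₗ proj g = proj g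
  proj_ne : ∀ g h, g ≠ h → proj g ∘ₗ proj h = 0
  sum_proj : ∑ g, proj g = LinearMap.id
  act_proj : ∀ g h, act g ∘ₗ proj h = proj (g * h * g⁻¹) ∘ₗ act g

namespace YetterDrinfeld

variable {R G M N : Type*} [CommRing R] [Group G] [Fintype G]
  [AddCommGroup M] [Module R M] [AddCommGroup N] [Module R N]

/-- The unit object: trivial action, everything of degree `1`. -/
def unit (R G : Type*) [CommRing R] [Group G] [Fintype G] : YetterDrinfeld R G R where
  act := Representation.trivial R G R
  proj := open Classical in fun g => if g = 1 then LinearMap.id else 0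
  proj_self g := by
    by_cases h : g = 1 <;> simp [h]
  proj_ne g h hgh := by
    by_cases h1 : g = 1
    · have h2 : h ≠ 1 := fun h2 => hgh (h1.trans h2.symm)
      simp [h2]
    · simp [h1]
  sum_proj := by
    rw [Finset.sum_eq_single 1 (fun g _ hg => if_neg hg) (by simp)]
    exact if_pos rfl
  act_proj g h := by
    have : g * h * g⁻¹ = 1 ↔ h = 1 := by
      rw [mul_inv_eq_one]; simp
    by_cases h1 : h = 1 <;> ext <;> simp [this, h1]

theorem unit_proj_one : (unit R G).proj 1 = LinearMap.id := if_pos rfl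

theorem unit_proj_ne {g : G} (hg : g ≠ 1) : (unit R G).proj g = 0 := if_neg hg

/-- The tensor product: diagonal action, and `M_a ⊗ N_b` has degree `a b`. -/
def tensor (Y : YetterDrinfeld R G M) (Z : YetterDrinfeld R G N) :
    YetterDrinfeld R G (M ⊗[R] N) where
  act := Y.act.tprod Z.act
  proj g := ∑ a, TensorProduct.map (Y.proj a) (Z.proj (a⁻¹ * g))
  proj_self g := by
    classical
    ext x y
    simp only [TensorProduct.AlgebraTensorModule.curry_apply, LinearMap.restrictScalars_self,
      TensorProduct.curry_apply, LinearMap.comp_apply, LinearMap.sum_apply,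
      TensorProduct.map_tmul, map_sum]
    refine Finset.sum_congr rfl fun a _ => ?_
    rw [Finset.sum_eq_single a]
    · rw [← LinearMap.comp_apply, ← LinearMap.comp_apply, proj_self, proj_self]
    · intro b _ hb
      rw [← LinearMap.comp_apply, proj_ne _ _ _ hb]; simp
    · simp
  proj_ne g h hgh := by
    classical
    ext x y
    simp only [TensorProduct.AlgebraTensorModule.curry_apply, LinearMap.restrictScalars_self,
      TensorProduct.curry_apply, LinearMap.comp_apply, LinearMap.sum_apply,
      TensorProduct.map_tmul, map_sum, LinearMap.zero_apply]
    refine Finset.sum_eq_zero fun a _ => Finset.sum_eq_zero fun b _ => ?_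
    by_cases hb : b = a
    · subst hb
      rw [← LinearMap.comp_apply (Z.proj _), proj_ne _ _ _ (by simpa using hgh)]; simp
    · rw [← LinearMap.comp_apply, proj_ne _ _ _ hb]; simp
  sum_proj := by
    rw [Finset.sum_comm]
    have h : ∀ a : G, ∑ g, TensorProduct.map (Y.proj a) (Z.proj (a⁻¹ * g)) =
        TensorProduct.map (Y.proj a) LinearMap.id := by
      intro a
      rw [← Z.sum_proj, ← Equiv.sum_comp (Equiv.mulLeft a⁻¹) Z.proj]
      ext x y
      simp [TensorProduct.tmul_sum]
    simp only [h]
    ext x y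
    have := congrArg (fun f : M →ₗ[R] M => f x ⊗ₜ[R] y) Y.sum_proj
    simpa [TensorProduct.sum_tmul] using this
  act_proj g h := by
    ext x y
    simp only [TensorProduct.AlgebraTensorModule.curry_apply, LinearMap.restrictScalars_self,
      TensorProduct.curry_apply, LinearMap.comp_apply, LinearMap.sum_apply,
      TensorProduct.map_tmul, map_sum, Representation.tprod_apply]
    refine Fintype.sum_equiv (MulAut.conj g).toEquiv _ _ fun a => ?_
    rw [← LinearMap.comp_apply (Y.act g), ← LinearMap.comp_apply (Z.act g), act_proj, act_proj]
    simp [mul_assoc]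

/-- The braiding `v ⊗ w ↦ ∑ g, (g · w) ⊗ v_g`. -/
def braiding (Y : YetterDrinfeld R G M) (Z : YetterDrinfeld R G N) : M ⊗[R] N →ₗ[R] N ⊗[R] M :=
  ∑ g, TensorProduct.map (Z.act g) (Y.proj g) ∘ₗ (TensorProduct.comm R M N).toLinearMap

/-- Morphisms of Yetter-Drinfeld modules: linear maps preserving action and coaction. -/
structure IsHom (Y : YetterDrinfeld R G M) (Z : YetterDrinfeld R G N) (f : M →ₗ[R] N) : Prop where
  act : ∀ g, f ∘ₗ Y.act g = Z.act g ∘ₗ f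
  proj : ∀ g, f ∘ₗ Y.proj g = Z.proj g ∘ₗ f

/-- Extension of scalars. -/
def baseChange (A : Type*) [CommRing A] [Algebra R A] (Y : YetterDrinfeld R G M) :
    YetterDrinfeld A G (A ⊗[R] M) where
  act :=
    { toFun := fun g => (Y.act g).baseChange A
      map_one' := by ext; simp
      map_mul' := fun g h => by ext; simp }
  proj g := (Y.proj g).baseChange A
  proj_self g := by rw [← LinearMap.baseChange_comp, proj_self]
  proj_ne g h hgh := by rw [← LinearMap.baseChange_comp, proj_ne _ _ _ hgh, LinearMap.baseChange_zero]
  sum_proj := by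
    ext x
    have := congrArg (fun f : M →ₗ[R] M => (1 : A) ⊗ₜ[R] f x) Y.sum_proj
    simpa [TensorProduct.tmul_sum] using this
  act_proj g h := by
    change (Y.act g).baseChange A ∘ₗ _ = _ ∘ₗ (Y.act g).baseChange A
    rw [← LinearMap.baseChange_comp, ← LinearMap.baseChange_comp, act_proj]

end YetterDrinfeld

/-! ## Bialgebras relative to a braiding -/

/-- `id ⊗ c ⊗ id` on `(M ⊗ M) ⊗ (M ⊗ M)`. -/
def midBraiding {R M : Type*} [CommRing R] [AddCommGroup M] [Module R M]
    (c : M ⊗[R] M →ₗ[R] M ⊗[R] M) :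
    (M ⊗[R] M) ⊗[R] (M ⊗[R] M) →ₗ[R] (M ⊗[R] M) ⊗[R] (M ⊗[R] M) :=
  (TensorProduct.assoc R M M (M ⊗[R] M)).symm.toLinearMap ∘ₗ
    LinearMap.lTensor M ((TensorProduct.assoc R M M M).toLinearMap ∘ₗ
      LinearMap.rTensor M c ∘ₗ (TensorProduct.assoc R M M M).symm.toLinearMap) ∘ₗ
    (TensorProduct.assoc R M M (M ⊗[R] M)).toLinearMap

/-- `c_{M ⊗ M, M} = (c ⊗ id) (id ⊗ c)`. -/
def braidingLeft {R M : Type*} [CommRing R] [AddCommGroup M] [Module R M]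
    (c : M ⊗[R] M →ₗ[R] M ⊗[R] M) : (M ⊗[R] M) ⊗[R] M →ₗ[R] M ⊗[R] (M ⊗[R] M) :=
  (TensorProduct.assoc R M M M).toLinearMap ∘ₗ LinearMap.rTensor M c ∘ₗ
    (TensorProduct.assoc R M M M).symm.toLinearMap ∘ₗ LinearMap.lTensor M c ∘ₗ
    (TensorProduct.assoc R M M M).toLinearMap

/-- `c_{M, M ⊗ M} = (id ⊗ c) (c ⊗ id)`. -/
def braidingRight {R M : Type*} [CommRing R] [AddCommGroup M] [Module R M]
    (c : M ⊗[R] M →ₗ[R] M ⊗[R] M) : M ⊗[R] (M ⊗[R] M) →ₗ[R] (M ⊗[R] M) ⊗[R] M :=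
  (TensorProduct.assoc R M M M).symm.toLinearMap ∘ₗ LinearMap.lTensor M c ∘ₗ
    (TensorProduct.assoc R M M M).toLinearMap ∘ₗ LinearMap.rTensor M c ∘ₗ
    (TensorProduct.assoc R M M M).symm.toLinearMap

/-- The four structure maps of a bialgebra, without any axiom. -/
structure BialgebraData (R M : Type*) [CommRing R] [AddCommGroup M] [Module R M] where
  mul : M ⊗[R] M →ₗ[R] M
  unit : R →ₗ[R] M
  comul : M →ₗ[R] M ⊗[R] M
  counit : M →ₗ[R] R

namespace BialgebraData

variable {R G M : Type*} [CommRing R] [Group G] [Fintype G] [AddCommGroup M] [Module R M]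

/-- The bialgebra axioms with respect to `c : M ⊗ M → M ⊗ M`. -/
structure IsBialgebra (S : BialgebraData R M) (c : M ⊗[R] M →ₗ[R] M ⊗[R] M) : Prop where
  mul_assoc : S.mul ∘ₗ LinearMap.rTensor M S.mul =
    S.mul ∘ₗ LinearMap.lTensor M S.mul ∘ₗ (TensorProduct.assoc R M M M).toLinearMap
  unit_mul : S.mul ∘ₗ LinearMap.rTensor M S.unit = (TensorProduct.lid R M).toLinearMap
  mul_unit : S.mul ∘ₗ LinearMap.lTensor M S.unit = (TensorProduct.rid R M).toLinearMap
  comul_coassoc : (TensorProduct.assoc R M M M).toLinearMap ∘ₗ LinearMap.rTensor M S.comul ∘ₗ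
    S.comul = LinearMap.lTensor M S.comul ∘ₗ S.comul
  counit_comul : LinearMap.rTensor M S.counit ∘ₗ S.comul =
    (TensorProduct.lid R M).symm.toLinearMap
  comul_counit : LinearMap.lTensor M S.counit ∘ₗ S.comul =
    (TensorProduct.rid R M).symm.toLinearMap
  comul_mul : S.comul ∘ₗ S.mul =
    TensorProduct.map S.mul S.mul ∘ₗ midBraiding c ∘ₗ TensorProduct.map S.comul S.comul
  comul_unit : S.comul (S.unit 1) = S.unit 1 ⊗ₜ[R] S.unit 1
  counit_mul : S.counit ∘ₗ S.mul =
    (TensorProduct.lid R R).toLinearMap ∘ₗ TensorProduct.map S.counit S.counit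
  counit_unit : S.counit ∘ₗ S.unit = LinearMap.id

/-- The structure maps are morphisms of Yetter-Drinfeld modules. -/
structure IsYetterDrinfeld (S : BialgebraData R M) (Y : YetterDrinfeld R G M) : Prop where
  mul : (Y.tensor Y).IsHom Y S.mul
  unit : (YetterDrinfeld.unit R G).IsHom Y S.unit
  comul : Y.IsHom (Y.tensor Y) S.comul
  counit : Y.IsHom (YetterDrinfeld.unit R G) S.counit

/-- The structure maps commute with the braiding that `c` induces among the tensor powers of `M`
(the braiding with the zeroth tensor power `R` is the flip). -/
structure CommutesWith (S : BialgebraData R M) (c : M ⊗[R] M →ₗ[R] M ⊗[R] M) : Prop where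
  mul_left : c ∘ₗ LinearMap.rTensor M S.mul = LinearMap.lTensor M S.mul ∘ₗ braidingLeft c
  mul_right : c ∘ₗ LinearMap.lTensor M S.mul = LinearMap.rTensor M S.mul ∘ₗ braidingRight c
  unit_left : c ∘ₗ LinearMap.rTensor M S.unit =
    LinearMap.lTensor M S.unit ∘ₗ (TensorProduct.comm R R M).toLinearMap
  unit_right : c ∘ₗ LinearMap.lTensor M S.unit =
    LinearMap.rTensor M S.unit ∘ₗ (TensorProduct.comm R M R).toLinearMap
  comul_left : braidingLeft c ∘ₗ LinearMap.rTensor M S.comul =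
    LinearMap.lTensor M S.comul ∘ₗ c
  comul_right : braidingRight c ∘ₗ LinearMap.lTensor M S.comul =
    LinearMap.rTensor M S.comul ∘ₗ c
  counit_left : (TensorProduct.comm R R M).toLinearMap ∘ₗ LinearMap.rTensor M S.counit =
    LinearMap.lTensor M S.counit ∘ₗ c
  counit_right : (TensorProduct.comm R M R).toLinearMap ∘ₗ LinearMap.lTensor M S.counit =
    LinearMap.rTensor M S.counit ∘ₗ c

/-- Extension of scalars of the structure maps. -/
def baseChange (A : Type*) [CommRing A] [Algebra R A] (S : BialgebraData R M) :
    BialgebraData A (A ⊗[R] M) where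
  mul := S.mul.baseChange A ∘ₗ
    (TensorProduct.AlgebraTensorModule.distribBaseChange R A M M).symm.toLinearMap
  unit := S.unit.baseChange A ∘ₗ (TensorProduct.AlgebraTensorModule.rid R A A).symm.toLinearMap
  comul := (TensorProduct.AlgebraTensorModule.distribBaseChange R A M M).toLinearMap ∘ₗ
    S.comul.baseChange A
  counit := (TensorProduct.AlgebraTensorModule.rid R A A).toLinearMap ∘ₗ S.counit.baseChange A

end BialgebraData

/-! ## Gradings -/

/-- `f` is homogeneous of degree zero for the gradings `A` and `B`. -/
def IsGradedMap {M N : Type*} [AddCommGroup M] [AddCommGroup N]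
    (A : ℕ → AddSubgroup M) (B : ℕ → AddSubgroup N) (f : M → N) : Prop :=
  ∀ d, ∀ x ∈ A d, f x ∈ B d

/-- The total grading of a tensor product. -/
def tensorGrading (R : Type*) {M N : Type*} [CommRing R] [AddCommGroup M] [Module R M]
    [AddCommGroup N] [Module R N] (A : ℕ → AddSubgroup M) (B : ℕ → AddSubgroup N) (d : ℕ) :
    AddSubgroup (M ⊗[R] N) :=
  AddSubgroup.closure {z | ∃ i j, i + j = d ∧ ∃ a ∈ A i, ∃ b ∈ B j, z = a ⊗ₜ[R] b}

/-- The grading of the ground ring concentrated in degree `0`. -/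
def scalarGrading (R : Type*) [CommRing R] (d : ℕ) : AddSubgroup R := if d = 0 then ⊤ else ⊥

/-- The standard grading of `R[t]`: the component of degree `d` is `R t ^ d`. -/
def polynomialGrading (R : Type*) [CommRing R] (d : ℕ) : AddSubgroup (Polynomial R) :=
  (LinearMap.range (Polynomial.monomial (R := R) d)).toAddSubgroup

/-- The structure maps are graded; `A` is the grading of the scalars and `B` that of `M`. -/
structure BialgebraData.IsGraded {R M : Type*} [CommRing R] [AddCommGroup M] [Module R M]
    (S : BialgebraData R M) (A : ℕ → AddSubgroup R) (B : ℕ → AddSubgroup M) : Prop where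
  mul : IsGradedMap (tensorGrading R B B) B S.mul
  unit : IsGradedMap A B S.unit
  comul : IsGradedMap B (tensorGrading R B B) S.comul
  counit : IsGradedMap B A S.counit

/-- A graded bialgebra in the category of Yetter-Drinfeld modules over `k[G]`. -/
structure GradedYDBialgebra (k G B : Type*) [CommRing k] [Group G] [Fintype G]
    [AddCommGroup B] [Module k B] where
  yd : YetterDrinfeld k G B
  data : BialgebraData k B
  gr : ℕ → Submodule k B
  isInternal : DirectSum.IsInternal gr
  act_mem : ∀ g d, ∀ b ∈ gr d, yd.act g b ∈ gr d
  proj_mem : ∀ g d, ∀ b ∈ gr d, yd.proj g b ∈ gr d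
  isBialgebra : data.IsBialgebra (yd.braiding yd)
  isYetterDrinfeld : data.IsYetterDrinfeld yd
  isGraded : data.IsGraded (scalarGrading k) (fun d => (gr d).toAddSubgroup)

/-! ## Graded deformations -/

/-- Setting `t = 0`, as a map `k[t] ⊗ M → M`. -/
def specializeZero (k M : Type*) [CommRing k] [AddCommGroup M] [Module k M] :
    Polynomial k ⊗[k] M →ₗ[k] M :=
  (TensorProduct.lid k M).toLinearMap ∘ₗ LinearMap.rTensor M (Polynomial.lcoeff k 0)

namespace GradedYDBialgebra

variable {k G B : Type*} [CommRing k] [Group G] [Fintype G] [AddCommGroup B] [Module k B]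

/-- The Yetter-Drinfeld module `B[t] = k[t] ⊗ B` over `k[t]`. -/
def ydT (H : GradedYDBialgebra k G B) :
    YetterDrinfeld (Polynomial k) G (Polynomial k ⊗[k] B) :=
  H.yd.baseChange (Polynomial k)

/-- The grading of `B[t]`, with `t` in degree `1`. -/
def grT (H : GradedYDBialgebra k G B) : ℕ → AddSubgroup (Polynomial k ⊗[k] B) :=
  tensorGrading k (polynomialGrading k) (fun d => (H.gr d).toAddSubgroup)

/-- The braiding of `B[t]`. -/
def braidingT (H : GradedYDBialgebra k G B) :
    (Polynomial k ⊗[k] B) ⊗[Polynomial k] (Polynomial k ⊗[k] B) →ₗ[Polynomial k]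
      (Polynomial k ⊗[k] B) ⊗[Polynomial k] (Polynomial k ⊗[k] B) :=
  H.ydT.braiding H.ydT

/-- The trivial deformation: the structure maps of `B` extended `k[t]`-linearly. -/
def trivialDeformation (H : GradedYDBialgebra k G B) :
    BialgebraData (Polynomial k) (Polynomial k ⊗[k] B) :=
  H.data.baseChange (Polynomial k)

/-- `(m_t, Δ_t)` on `B[t]` is a `k[t]`-linear graded bialgebra structure, for the braiding of
`B[t]`, that specializes at `t = 0` to `(m, Δ)`. (Whether the structure maps are morphisms is
required separately.) -/
structure IsDeformation (H : GradedYDBialgebra k G B)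
    (S : BialgebraData (Polynomial k) (Polynomial k ⊗[k] B)) : Prop where
  isBialgebra : S.IsBialgebra H.braidingT
  isGraded : S.IsGraded (polynomialGrading k) H.grT
  mul_zero : ∀ a b : B, specializeZero k B (S.mul ((1 ⊗ₜ[k] a) ⊗ₜ[Polynomial k] (1 ⊗ₜ[k] b))) =
    H.data.mul (a ⊗ₜ[k] b)
  comul_zero : ∀ b : B, specializeZero k (B ⊗[k] B)
    ((TensorProduct.AlgebraTensorModule.distribBaseChange k (Polynomial k) B B).symm
      (S.comul (1 ⊗ₜ[k] b))) = H.data.comul b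

/-- A graded deformation of `H` in the category of Yetter-Drinfeld modules. -/
structure IsYDDeformation (H : GradedYDBialgebra k G B)
    (S : BialgebraData (Polynomial k) (Polynomial k ⊗[k] B)) : Prop extends
    H.IsDeformation S where
  isYetterDrinfeld : S.IsYetterDrinfeld H.ydT

/-- A graded deformation of `H` as a braided bialgebra (with a fixed braiding), without reference
to a category: the structure maps commute with the braiding. -/
structure IsBraidedDeformation (H : GradedYDBialgebra k G B)
    (S : BialgebraData (Polynomial k) (Polynomial k ⊗[k] B)) : Prop extends
    H.IsDeformation S where
  commutesWith : S.CommutesWith H.braidingT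

/-- `f` is a `k[t]`-linear graded bialgebra isomorphism `(B[t], S) → (B[t], S')`. -/
structure IsGradedBialgebraIso (H : GradedYDBialgebra k G B)
    (S S' : BialgebraData (Polynomial k) (Polynomial k ⊗[k] B))
    (f : (Polynomial k ⊗[k] B) ≃ₗ[Polynomial k] (Polynomial k ⊗[k] B)) : Prop where
  graded : IsGradedMap H.grT H.grT f
  graded_symm : IsGradedMap H.grT H.grT f.symm
  mul : f.toLinearMap ∘ₗ S.mul = S'.mul ∘ₗ TensorProduct.map f.toLinearMap f.toLinearMap
  unit : f.toLinearMap ∘ₗ S.unit = S'.unit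
  comul : TensorProduct.map f.toLinearMap f.toLinearMap ∘ₗ S.comul = S'.comul ∘ₗ f.toLinearMap
  counit : S'.counit ∘ₗ f.toLinearMap = S.counit

/-- Equivalence of graded deformations in the category of Yetter-Drinfeld modules. -/
structure IsYDEquivalence (H : GradedYDBialgebra k G B)
    (S S' : BialgebraData (Polynomial k) (Polynomial k ⊗[k] B))
    (f : (Polynomial k ⊗[k] B) ≃ₗ[Polynomial k] (Polynomial k ⊗[k] B)) : Prop extends
    H.IsGradedBialgebraIso S S' f where
  isHom : H.ydT.IsHom H.ydT f.toLinearMap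

/-- Equivalence of graded deformations as braided bialgebras: `f` commutes with the braiding. -/
structure IsBraidedEquivalence (H : GradedYDBialgebra k G B)
    (S S' : BialgebraData (Polynomial k) (Polynomial k ⊗[k] B))
    (f : (Polynomial k ⊗[k] B) ≃ₗ[Polynomial k] (Polynomial k ⊗[k] B)) : Prop extends
    H.IsGradedBialgebraIso S S' f where
  braiding_left : H.braidingT ∘ₗ LinearMap.rTensor _ f.toLinearMap =
    LinearMap.lTensor _ f.toLinearMap ∘ₗ H.braidingT
  braiding_right : H.braidingT ∘ₗ LinearMap.lTensor _ f.toLinearMap =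
    LinearMap.rTensor _ f.toLinearMap ∘ₗ H.braidingT

/-- `f` is the identity modulo `t`. -/
def IsIdAtZero (f : (Polynomial k ⊗[k] B) ≃ₗ[Polynomial k] (Polynomial k ⊗[k] B)) : Prop :=
  ∀ b : B, specializeZero k B (f (1 ⊗ₜ[k] b)) = b

/-- No nontrivial graded deformations in the category of Yetter-Drinfeld modules: every such
deformation is equivalent to the trivial one, by an equivalence that is the identity at `t = 0`. -/
def IsYDRigid (H : GradedYDBialgebra k G B) : Prop :=
  ∀ S, H.IsYDDeformation S → ∃ f, H.IsYDEquivalence S H.trivialDeformation f ∧ IsIdAtZero f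

/-- No nontrivial graded deformations as a braided bialgebra. -/
def IsBraidedRigid (H : GradedYDBialgebra k G B) : Prop :=
  ∀ S, H.IsBraidedDeformation S →
    ∃ f, H.IsBraidedEquivalence S H.trivialDeformation f ∧ IsIdAtZero f

end GradedYDBialgebra

/-! ## The Fomin-Kirillov algebra -/

namespace FominKirillov

/-- The generators `x_(ij)` are indexed by the pairs `i < j`. -/
abbrev Gen (n : ℕ) := {p : Fin n × Fin n // p.1 < p.2}

/-- The generator `x_(ij)` in the free algebra. -/
abbrev freeGen (k : Type*) [CommRing k] {n : ℕ} (i j : Fin n) (h : i < j) :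
    FreeAlgebra k (Gen n) :=
  FreeAlgebra.ι k ⟨(i, j), h⟩

/-- The defining relations. -/
inductive Rel (k : Type*) [CommRing k] (n : ℕ) :
    FreeAlgebra k (Gen n) → FreeAlgebra k (Gen n) → Prop
  | sq (i j : Fin n) (hij : i < j) : Rel k n (freeGen k i j hij * freeGen k i j hij) 0
  | cyc₁ (i j l : Fin n) (hij : i < j) (hjl : j < l) :
      Rel k n (freeGen k i j hij * freeGen k j l hjl)
        (freeGen k j l hjl * freeGen k i l (hij.trans hjl) +
          freeGen k i l (hij.trans hjl) * freeGen k i j hij)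
  | cyc₂ (i j l : Fin n) (hij : i < j) (hjl : j < l) :
      Rel k n (freeGen k j l hjl * freeGen k i j hij)
        (freeGen k i l (hij.trans hjl) * freeGen k j l hjl +
          freeGen k i j hij * freeGen k i l (hij.trans hjl))
  | comm (i j l m : Fin n) (hij : i < j) (hlm : l < m)
      (hil : i ≠ l) (him : i ≠ m) (hjl : j ≠ l) (hjm : j ≠ m) :
      Rel k n (freeGen k i j hij * freeGen k l m hlm) (freeGen k l m hlm * freeGen k i j hij)

end FominKirillov

/-- The Fomin-Kirillov algebra `FK_n` over `k`. -/
def FominKirillov (k : Type*) [CommRing k] (n : ℕ) := RingQuot (FominKirillov.Rel k n)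

namespace FominKirillov

instance (k : Type*) [CommRing k] (n : ℕ) : Ring (FominKirillov k n) :=
  inferInstanceAs (Ring (RingQuot (Rel k n)))

instance (k : Type*) [CommRing k] (n : ℕ) : Algebra k (FominKirillov k n) :=
  inferInstanceAs (Algebra k (RingQuot (Rel k n)))

/-- The quotient map. -/
def mk (k : Type*) [CommRing k] (n : ℕ) : FreeAlgebra k (Gen n) →ₐ[k] FominKirillov k n :=
  RingQuot.mkAlgHom k (Rel k n)

theorem mk_rel {k : Type*} [CommRing k] {n : ℕ} {a b : FreeAlgebra k (Gen n)}
    (h : Rel k n a b) : mk k n a = mk k n b := RingQuot.mkAlgHom_rel k h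

theorem mk_surjective (k : Type*) [CommRing k] (n : ℕ) : Function.Surjective (mk k n) :=
  RingQuot.mkAlgHom_surjective k (Rel k n)

variable (k : Type*) [CommRing k] (n : ℕ)

variable {n} in
/-- The generators extended to all pairs of indices by `x_(ji) = - x_(ij)` and `x_(ii) = 0`. -/
def x (i j : Fin n) : FominKirillov k n :=
  if h : i < j then mk k n (freeGen k i j h)
  else if h : j < i then - mk k n (freeGen k j i h)
  else 0

variable {k n}

theorem x_of_lt {i j : Fin n} (h : i < j) :
    x k i j = mk k n (freeGen k i j h) := by
  simp [x, h]

theorem x_self (i : Fin n) : x k i i = 0 := by simp [x]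

theorem x_anti (i j : Fin n) : x k j i = - x k i j := by
  rcases lt_trichotomy i j with h | h | h
  · simp [x, h, h.not_gt]
  · subst h; simp [x_self]
  · simp [x, h, h.not_gt]

theorem x_sq (i j : Fin n) : x k i j * x k i j = 0 := by
  have key : ∀ i j : Fin n, i < j → x k i j * x k i j = 0 := fun i j h => by
    rw [x_of_lt h, ← map_mul, mk_rel (Rel.sq i j h), map_zero]
  rcases lt_trichotomy i j with h | h | h
  · exact key i j h
  · subst h; simp [x_self]
  · rw [x_anti j i, neg_mul_neg, key j i h]

theorem x_cyc (i j l : Fin n) (hij : i ≠ j) (hjl : j ≠ l) (hil : i ≠ l) :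
    x k i j * x k j l + x k j l * x k l i + x k l i * x k i j = 0 := by
  have rot : ∀ a b c : Fin n, x k a b * x k b c + x k b c * x k c a + x k c a * x k a b = 0 →
      x k b c * x k c a + x k c a * x k a b + x k a b * x k b c = 0 := fun a b c h => by
    rw [← h]; abel
  have base₁ : ∀ a b c : Fin n, a < b → b < c →
      x k a b * x k b c + x k b c * x k c a + x k c a * x k a b = 0 := fun a b c h₁ h₂ => by
    have := mk_rel (Rel.cyc₁ (k := k) a b c h₁ h₂)
    simp only [map_mul, map_add, ← x_of_lt] at this
    rw [this, x_anti a c]; noncomm_ring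
  have base₂ : ∀ a b c : Fin n, a < b → b < c →
      x k c b * x k b a + x k b a * x k a c + x k a c * x k c b = 0 := fun a b c h₁ h₂ => by
    have := mk_rel (Rel.cyc₂ (k := k) a b c h₁ h₂)
    simp only [map_mul, map_add, ← x_of_lt] at this
    rw [x_anti b c, x_anti a b, neg_mul_neg, this]; noncomm_ring
  rcases lt_or_gt_of_ne hij with h₁ | h₁ <;> rcases lt_or_gt_of_ne hjl with h₂ | h₂ <;>
    rcases lt_or_gt_of_ne hil with h₃ | h₃
  · exact base₁ _ _ _ h₁ h₂
  · exact absurd (h₁.trans h₂) h₃.not_gt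
  · exact rot _ _ _ (rot _ _ _ (base₂ _ _ _ h₃ h₂) )
  · exact rot _ _ _ (base₁ _ _ _ h₃ h₁)
  · exact rot _ _ _ (base₂ _ _ _ h₁ h₃)
  · exact rot _ _ _ (rot _ _ _ (base₁ _ _ _ h₂ h₃))
  · exact absurd (h₂.trans h₁) h₃.not_gt
  · exact base₂ _ _ _ h₂ h₁

theorem x_comm (i j l m : Fin n) (hil : i ≠ l) (him : i ≠ m) (hjl : j ≠ l) (hjm : j ≠ m) :
    x k i j * x k l m = x k l m * x k i j := by
  have key : ∀ i j l m : Fin n, i < j → l < m → i ≠ l → i ≠ m → j ≠ l → j ≠ m →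
      x k i j * x k l m = x k l m * x k i j := fun i j l m h₁ h₂ a b c d => by
    have := mk_rel (Rel.comm (k := k) i j l m h₁ h₂ a b c d)
    simpa only [map_mul, ← x_of_lt] using this
  rcases lt_trichotomy i j with h₁ | h₁ | h₁
  · rcases lt_trichotomy l m with h₂ | h₂ | h₂
    · exact key _ _ _ _ h₁ h₂ hil him hjl hjm
    · subst h₂; simp [x_self]
    · simpa [x_anti m l] using key _ _ _ _ h₁ h₂ him hil hjm hjl
  · subst h₁; simp [x_self]
  · rcases lt_trichotomy l m with h₂ | h₂ | h₂
    · simpa [x_anti j i] using key _ _ _ _ h₁ h₂ hjl hjm hil him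
    · subst h₂; simp [x_self]
    · simpa [x_anti m l, x_anti j i] using key _ _ _ _ h₁ h₂ hjm hjl him hil

/-- A family `z` satisfying the relations of the `x_(ij)`. -/
structure IsFK {A : Type*} [Ring A] (z : Fin n → Fin n → A) : Prop where
  self : ∀ i, z i i = 0
  anti : ∀ i j, z j i = - z i j
  sq : ∀ i j, i ≠ j → z i j * z i j = 0
  cyc : ∀ i j l, i ≠ j → j ≠ l → i ≠ l → z i j * z j l + z j l * z l i + z l i * z i j = 0
  comm : ∀ i j l m, i ≠ j → l ≠ m → i ≠ l → i ≠ m → j ≠ l → j ≠ m → z i j * z l m = z l m * z i j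

/-- The universal property of `FK_n`. -/
def lift {A : Type*} [Ring A] [Algebra k A] (z : Fin n → Fin n → A) (hz : IsFK z) :
    FominKirillov k n →ₐ[k] A :=
  RingQuot.liftAlgHom k ⟨FreeAlgebra.lift k fun p : Gen n => z p.1.1 p.1.2, by
    intro a b hab
    cases hab with
    | sq i j hij => simpa using hz.sq i j hij.ne
    | cyc₁ i j l hij hjl =>
      have h := hz.cyc i j l hij.ne hjl.ne (hij.trans hjl).ne
      rw [hz.anti i l] at h
      simp only [map_mul, map_add, FreeAlgebra.lift_ι_apply]
      rw [← sub_eq_zero, ← h]; noncomm_ring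
    | cyc₂ i j l hij hjl =>
      have h := hz.cyc l j i hjl.ne' hij.ne' (hij.trans hjl).ne'
      rw [hz.anti i j, hz.anti j l] at h
      simp only [map_mul, map_add, FreeAlgebra.lift_ι_apply]
      rw [← sub_eq_zero, ← h]; noncomm_ring
    | comm i j l m hij hlm a b c d =>
      simpa using hz.comm i j l m hij.ne hlm.ne a b c d⟩

theorem lift_x {A : Type*} [Ring A] [Algebra k A] (z : Fin n → Fin n → A) (hz : IsFK z)
    (i j : Fin n) : lift (k := k) z hz (x k i j) = z i j := by
  have key : ∀ i j : Fin n, i < j → lift (k := k) z hz (x k i j) = z i j := fun i j h => by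
    rw [x_of_lt h]
    exact (RingQuot.liftAlgHom_mkAlgHom_apply _ _ _ _).trans (FreeAlgebra.lift_ι_apply _ _)
  rcases lt_trichotomy i j with h | h | h
  · exact key i j h
  · subst h; rw [x_self, map_zero, hz.self]
  · rw [x_anti j i, map_neg, key j i h, hz.anti j i]

/-! ### Monomials -/

/-- The monomial in the `x_(ij)` given by a list of pairs. -/
def mono (k : Type*) [CommRing k] {n : ℕ} (w : List (Fin n × Fin n)) : FominKirillov k n :=
  (w.map fun p => x k p.1 p.2).prod

/-- The degree in `S_n` of a monomial. -/
def deg {n : ℕ} (w : List (Fin n × Fin n)) : Equiv.Perm (Fin n) :=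
  (w.map fun p => Equiv.swap p.1 p.2).prod

theorem mono_nil : mono k ([] : List (Fin n × Fin n)) = 1 := rfl

theorem mono_cons (p : Fin n × Fin n) (w : List (Fin n × Fin n)) :
    mono k (p :: w) = x k p.1 p.2 * mono k w := by simp [mono]

theorem mono_append (v w : List (Fin n × Fin n)) : mono k (v ++ w) = mono k v * mono k w := by
  simp [mono]

theorem deg_nil : deg ([] : List (Fin n × Fin n)) = 1 := rfl

theorem deg_cons (p : Fin n × Fin n) (w : List (Fin n × Fin n)) :
    deg (p :: w) = Equiv.swap p.1 p.2 * deg w := by simp [deg]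

theorem deg_append (v w : List (Fin n × Fin n)) : deg (v ++ w) = deg v * deg w := by
  simp [deg]

theorem span_mono : Submodule.span k (Set.range (mono k (n := n))) = ⊤ := by
  rw [eq_top_iff]
  rintro b -
  obtain ⟨f, rfl⟩ := mk_surjective k n b
  have hmul : ∀ b ∈ Submodule.span k (Set.range (mono k (n := n))),
      ∀ c ∈ Submodule.span k (Set.range (mono k (n := n))),
      b * c ∈ Submodule.span k (Set.range (mono k (n := n))) := by
    intro b hb c hc
    have := Submodule.mul_mem_mul hb hc
    rw [Submodule.span_mul_span] at this
    refine Submodule.span_mono ?_ this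
    rintro _ ⟨_, ⟨v, rfl⟩, _, ⟨w, rfl⟩, rfl⟩
    exact ⟨v ++ w, mono_append v w⟩
  induction f using FreeAlgebra.induction with
  | grade0 r =>
    rw [AlgHom.commutes, Algebra.algebraMap_eq_smul_one]
    exact Submodule.smul_mem _ _ (Submodule.subset_span ⟨[], mono_nil⟩)
  | grade1 p =>
    refine Submodule.subset_span ⟨[p.1], ?_⟩
    rw [mono_cons, mono_nil, mul_one, x_of_lt p.2]
  | mul a b ha hb => rw [map_mul]; exact hmul _ ha _ hb
  | add a b ha hb => rw [map_add]; exact Submodule.add_mem _ ha hb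

theorem ext_mono {N : Type*} [AddCommGroup N] [Module k N] {f g : FominKirillov k n →ₗ[k] N}
    (h : ∀ w, f (mono k w) = g (mono k w)) : f = g :=
  LinearMap.ext_on span_mono (by rintro _ ⟨w, rfl⟩; exact h w)

theorem ext_mono₂ {N : Type*} [AddCommGroup N] [Module k N]
    {f g : FominKirillov k n ⊗[k] FominKirillov k n →ₗ[k] N}
    (h : ∀ v w, f (mono k v ⊗ₜ mono k w) = g (mono k v ⊗ₜ mono k w)) : f = g :=
  TensorProduct.ext (ext_mono fun v => ext_mono fun w => h v w)

/-! ### Action and coaction -/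

/-- The action of `S_n`: `g · x_(ij) = x_(g(i) g(j))`. For `i < j` this is `x_(g(i) g(j))` or
`- x_(g(j) g(i))` according to whether `g(i) < g(j)` or not, i.e. conjugation of
transpositions, twisted by the sign `χ(g, (ij))`. -/
def act (g : Equiv.Perm (Fin n)) : FominKirillov k n →ₐ[k] FominKirillov k n :=
  lift (fun i j => x k (g i) (g j))
    { self := fun _ => x_self _
      anti := fun _ _ => x_anti _ _
      sq := fun _ _ _ => x_sq _ _
      cyc := fun i j l a b c => x_cyc _ _ _ (by simpa using a) (by simpa using b) (by simpa using c)
      comm := fun i j l m _ _ a b c d => x_comm _ _ _ _ (by simpa using a) (by simpa using b)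
        (by simpa using c) (by simpa using d) }

theorem act_x (g : Equiv.Perm (Fin n)) (i j : Fin n) : act g (x k i j) = x k (g i) (g j) :=
  lift_x _ _ _ _

theorem act_mono (g : Equiv.Perm (Fin n)) (w : List (Fin n × Fin n)) :
    act g (mono k w) = mono k (w.map fun p => (g p.1, g p.2)) := by
  simp only [mono, map_list_prod, List.map_map]
  congr 1
  exact List.map_congr_left fun p _ => act_x _ _ _

theorem deg_map (g : Equiv.Perm (Fin n)) (w : List (Fin n × Fin n)) :
    deg (w.map fun p => (g p.1, g p.2)) = g * deg w * g⁻¹ := by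
  induction w with
  | nil => simp [deg_nil]
  | cons p w ih =>
    rw [List.map_cons, deg_cons, ih, deg_cons, Equiv.swap_apply_apply]
    group

theorem swap_cyc (i j l : Fin n) (hij : i ≠ j) (hil : i ≠ l) :
    Equiv.swap i j * Equiv.swap j l = Equiv.swap j l * Equiv.swap l i := by
  have := Equiv.mul_swap_eq_swap_mul (Equiv.swap j l) l i
  rw [this, Equiv.swap_apply_right, Equiv.swap_apply_of_ne_of_ne hij hil, Equiv.swap_comm]

/-- The coaction `FK_n → FK_n ⊗ k[S_n]`, the algebra homomorphism with `x_(ij) ↦ x_(ij) ⊗ (ij)`. -/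
def coact : FominKirillov k n →ₐ[k] MonoidAlgebra (FominKirillov k n) (Equiv.Perm (Fin n)) :=
  lift (fun i j => MonoidAlgebra.single (Equiv.swap i j) (x k i j))
    { self := fun _ => by rw [x_self, MonoidAlgebra.single_zero]
      anti := fun i j => by rw [x_anti, Equiv.swap_comm, MonoidAlgebra.single_neg]
      sq := fun i j _ => by rw [MonoidAlgebra.single_mul_single, x_sq, MonoidAlgebra.single_zero]
      cyc := fun i j l a b c => by
        simp only [MonoidAlgebra.single_mul_single]
        rw [swap_cyc i j l a c, swap_cyc j l i b a.symm, ← MonoidAlgebra.single_add,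
          ← MonoidAlgebra.single_add, x_cyc i j l a b c, MonoidAlgebra.single_zero]
      comm := fun i j l m h₁ h₂ a b c d => by
        simp only [MonoidAlgebra.single_mul_single]
        rw [x_comm i j l m a b c d, Equiv.mul_swap_eq_swap_mul (Equiv.swap i j),
          Equiv.swap_apply_of_ne_of_ne a.symm c.symm, Equiv.swap_apply_of_ne_of_ne b.symm d.symm] }

theorem coact_mono (w : List (Fin n × Fin n)) :
    coact (mono k w) = MonoidAlgebra.single (deg w) (mono k w) := by
  induction w with
  | nil => rw [mono_nil, map_one]; rfl
  | cons p w ih =>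
    rw [mono_cons, map_mul, ih, deg_cons, coact, lift_x, MonoidAlgebra.single_mul_single]

/-- The projection of `FK_n` onto the component of degree `g`. -/
def proj (g : Equiv.Perm (Fin n)) : FominKirillov k n →ₗ[k] FominKirillov k n where
  toFun b := (coact b).coeff g
  map_add' a b := by simp
  map_smul' r a := by simp

theorem proj_mono (g : Equiv.Perm (Fin n)) (w : List (Fin n × Fin n)) :
    proj g (mono k w) = if g = deg w then mono k w else 0 := by
  change (coact (mono k w)).coeff g = _
  rw [coact_mono]
  by_cases h : g = deg w
  · simp [h]
  · simp [h]

/-- `FK_n` as a Yetter-Drinfeld module over `S_n`. -/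
def yd (k : Type*) [CommRing k] (n : ℕ) :
    YetterDrinfeld k (Equiv.Perm (Fin n)) (FominKirillov k n) where
  act :=
    { toFun := fun g => (act g).toLinearMap
      map_one' := ext_mono fun w => by simp [act_mono]
      map_mul' := fun g h => ext_mono fun w => by
        change act _ _ = act _ (act _ _)
        simp [act_mono, Function.comp_def] }
  proj := proj
  proj_self g := ext_mono fun w => by
    rw [LinearMap.comp_apply, proj_mono]
    split_ifs with h <;> simp [proj_mono, h]
  proj_ne g h hgh := ext_mono fun w => by
    rw [LinearMap.comp_apply, proj_mono]
    split_ifs with h'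
    · rw [proj_mono, if_neg (fun e => hgh (e.trans h'.symm))]; rfl
    · simp
  sum_proj := ext_mono fun w => by
    simp [LinearMap.sum_apply, proj_mono]
  act_proj g h := ext_mono fun w => by
    change act g (proj h _) = proj _ (act g _)
    rw [proj_mono, act_mono, proj_mono, deg_map]
    simp only [mul_left_inj, mul_right_inj]
    split_ifs
    · rw [act_mono]
    · simp

/-! ### Comultiplication and counit -/

/-- Left multiplication by `x_(ij) ⊗ 1 + 1 ⊗ x_(ij)` in the braided tensor product algebra
`FK_n ⊗ FK_n`, that is `a ⊗ b ↦ x_(ij) a ⊗ b + ((ij) · a) ⊗ x_(ij) b`. -/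
def leftMul (i j : Fin n) : Module.End k (FominKirillov k n ⊗[k] FominKirillov k n) :=
  TensorProduct.map (LinearMap.mulLeft k (x k i j)) LinearMap.id +
    TensorProduct.map (act (Equiv.swap i j)).toLinearMap (LinearMap.mulLeft k (x k i j))

theorem leftMul_tmul (i j : Fin n) (a b : FominKirillov k n) :
    leftMul i j (a ⊗ₜ[k] b) =
      (x k i j * a) ⊗ₜ b + act (Equiv.swap i j) a ⊗ₜ (x k i j * b) := rfl

theorem act_mul_apply (g h : Equiv.Perm (Fin n)) (b : FominKirillov k n) :
    act g (act h b) = act (g * h) b :=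
  (congrArg (fun f => f b) ((yd k n).act.map_mul g h)).symm

theorem leftMul_leftMul (i j l m : Fin n) (a b : FominKirillov k n) :
    leftMul i j (leftMul l m (a ⊗ₜ[k] b)) =
      (x k i j * x k l m * a) ⊗ₜ b +
      (x k i j * act (Equiv.swap l m) a) ⊗ₜ (x k l m * b) +
      (x k (Equiv.swap i j l) (Equiv.swap i j m) * act (Equiv.swap i j) a) ⊗ₜ (x k i j * b) +
      act (Equiv.swap i j * Equiv.swap l m) a ⊗ₜ (x k i j * x k l m * b) := by
  simp only [leftMul_tmul, map_add, map_mul, act_x, act_mul_apply, mul_assoc]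
  abel

theorem isFK_leftMul : IsFK (leftMul (k := k) (n := n)) where
  self i := TensorProduct.ext' fun a b => by
    simp [leftMul_tmul, x_self]
  anti i j := TensorProduct.ext' fun a b => by
    rw [LinearMap.neg_apply, leftMul_tmul, leftMul_tmul, x_anti i j, Equiv.swap_comm]
    simp only [neg_mul, TensorProduct.neg_tmul, TensorProduct.tmul_neg]
    abel
  sq i j hij := TensorProduct.ext' fun a b => by
    rw [Module.End.mul_apply, leftMul_leftMul]
    rw [Equiv.swap_apply_left, Equiv.swap_apply_right, x_sq, x_anti i j]
    simp [TensorProduct.neg_tmul]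
  cyc i j l a b c := TensorProduct.ext' fun u v => by
    simp only [LinearMap.add_apply, Module.End.mul_apply, leftMul_leftMul, LinearMap.zero_apply]
    rw [Equiv.swap_apply_right, Equiv.swap_apply_right, Equiv.swap_apply_right,
      Equiv.swap_apply_of_ne_of_ne c.symm b.symm, Equiv.swap_apply_of_ne_of_ne a c,
      Equiv.swap_apply_of_ne_of_ne b a.symm, swap_cyc i j l a c, swap_cyc j l i b a.symm,
      x_anti l i, x_anti i j, x_anti j l]
    have h := x_cyc (k := k) i j l a b c
    have h₁ : (x k i j * x k j l * u) ⊗ₜ[k] v + (x k j l * x k l i * u) ⊗ₜ[k] v +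
        (x k l i * x k i j * u) ⊗ₜ[k] v = 0 := by
      rw [← TensorProduct.add_tmul, ← TensorProduct.add_tmul, ← add_mul, ← add_mul, h]; simp
    have h₂ : ∀ w : FominKirillov k n, w ⊗ₜ[k] (x k i j * x k j l * v) +
        w ⊗ₜ[k] (x k j l * x k l i * v) + w ⊗ₜ[k] (x k l i * x k i j * v) = 0 := fun w => by
      rw [← TensorProduct.tmul_add, ← TensorProduct.tmul_add, ← add_mul, ← add_mul, h]; simp
    refine Eq.trans ?_ ((congrArg₂ (· + ·) h₁
      (h₂ (act (Equiv.swap l i * Equiv.swap i j) u))).trans (add_zero 0))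
    simp only [neg_mul, TensorProduct.neg_tmul]
    abel
  comm i j l m h₁ h₂ a b c d := TensorProduct.ext' fun u v => by
    simp only [Module.End.mul_apply, leftMul_leftMul]
    rw [Equiv.swap_apply_of_ne_of_ne a.symm c.symm, Equiv.swap_apply_of_ne_of_ne b.symm d.symm,
      Equiv.swap_apply_of_ne_of_ne a b, Equiv.swap_apply_of_ne_of_ne c d,
      x_comm i j l m a b c d, Equiv.mul_swap_eq_swap_mul (Equiv.swap i j),
      Equiv.swap_apply_of_ne_of_ne a.symm c.symm, Equiv.swap_apply_of_ne_of_ne b.symm d.symm]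
    abel

/-- The comultiplication: the algebra homomorphism from `FK_n` to the braided tensor product
algebra `FK_n ⊗ FK_n` with `x_(ij) ↦ x_(ij) ⊗ 1 + 1 ⊗ x_(ij)`, obtained by applying the
corresponding operators of left multiplication to `1 ⊗ 1`. -/
def comul (k : Type*) [CommRing k] (n : ℕ) :
    FominKirillov k n →ₗ[k] FominKirillov k n ⊗[k] FominKirillov k n :=
  LinearMap.applyₗ (1 ⊗ₜ[k] 1) ∘ₗ (lift (k := k) leftMul isFK_leftMul).toLinearMap

theorem comul_one : comul k n 1 = 1 ⊗ₜ 1 := by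
  simp [comul]

theorem comul_x_mul (i j : Fin n) (b : FominKirillov k n) :
    comul k n (x k i j * b) = leftMul i j (comul k n b) := by
  simp [comul, lift_x]

theorem comul_x (i j : Fin n) : comul k n (x k i j) = x k i j ⊗ₜ 1 + 1 ⊗ₜ x k i j := by
  rw [← mul_one (x k i j), comul_x_mul, comul_one, leftMul_tmul]
  simp

/-- The counit, with `x_(ij) ↦ 0`. -/
def counit (k : Type*) [CommRing k] (n : ℕ) : FominKirillov k n →ₐ[k] k :=
  lift (fun _ _ => 0)
    { self := by simp, anti := by simp, sq := by simp, cyc := by simp, comm := by simp }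

theorem counit_x (i j : Fin n) : counit k n (x k i j) = 0 := lift_x _ _ _ _

/-- The structure maps of `FK_n`. -/
def data (k : Type*) [CommRing k] (n : ℕ) : BialgebraData k (FominKirillov k n) where
  mul := LinearMap.mul' k (FominKirillov k n)
  unit := Algebra.linearMap k (FominKirillov k n)
  comul := comul k n
  counit := (counit k n).toLinearMap

/-- The grading of `FK_n`: the component of degree `d` is spanned by the products of `d`
generators. -/
def gr (k : Type*) [CommRing k] (n d : ℕ) : Submodule k (FominKirillov k n) :=
  Submodule.span k {b | ∃ w : List (Fin n × Fin n), w.length = d ∧ b = mono k w}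

/-! ### Verification of the axioms -/

theorem braiding_mono (v : List (Fin n × Fin n)) (b : FominKirillov k n) :
    (yd k n).braiding (yd k n) (mono k v ⊗ₜ b) = act (deg v) b ⊗ₜ mono k v := by
  simp only [YetterDrinfeld.braiding, LinearMap.sum_apply, LinearMap.comp_apply,
    LinearEquiv.coe_coe, TensorProduct.comm_tmul, TensorProduct.map_tmul]
  rw [Finset.sum_eq_single (deg v)]
  · change act _ _ ⊗ₜ proj _ _ = _
    rw [proj_mono, if_pos rfl]
  · intro g _ hg
    change act _ _ ⊗ₜ proj _ _ = _
    rw [proj_mono, if_neg hg, TensorProduct.tmul_zero]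
  · simp

/-- On generators, `c(x_σ ⊗ x_τ) = χ(σ, τ) x_(στσ⁻¹) ⊗ x_σ`. -/
theorem braiding_x (i j l m : Fin n) :
    (yd k n).braiding (yd k n) (x k i j ⊗ₜ x k l m) =
      x k (Equiv.swap i j l) (Equiv.swap i j m) ⊗ₜ x k i j := by
  have h := braiding_mono (k := k) [(i, j)] (x k l m)
  rwa [act_x, mono_cons, mono_nil, mul_one, deg_cons, deg_nil, mul_one] at h

/-- The product of the braided tensor product algebra `FK_n ⊗ FK_n`. -/
def braidedMul (k : Type*) [CommRing k] (n : ℕ) :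
    (FominKirillov k n ⊗[k] FominKirillov k n) ⊗[k] (FominKirillov k n ⊗[k] FominKirillov k n)
      →ₗ[k] FominKirillov k n ⊗[k] FominKirillov k n :=
  TensorProduct.map (data k n).mul (data k n).mul ∘ₗ
    midBraiding ((yd k n).braiding (yd k n))

theorem braidedMul_mono (a : FominKirillov k n) (v : List (Fin n × Fin n))
    (c d : FominKirillov k n) :
    braidedMul k n ((a ⊗ₜ mono k v) ⊗ₜ (c ⊗ₜ d)) = (a * act (deg v) c) ⊗ₜ (mono k v * d) := by
  simp [braidedMul, midBraiding, braiding_mono, data]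

theorem braidedMul_one (z : FominKirillov k n ⊗[k] FominKirillov k n) :
    braidedMul k n ((1 ⊗ₜ 1) ⊗ₜ z) = z := by
  induction z with
  | zero => simp
  | add a b ha hb => rw [TensorProduct.tmul_add, map_add, ha, hb]
  | tmul c d =>
    rw [← mono_nil, braidedMul_mono, deg_nil]
    have : act (1 : Equiv.Perm (Fin n)) c = c := congrArg (fun f => f c) (yd k n).act.map_one
    rw [this, mono_nil, one_mul, one_mul]

theorem leftMul_braidedMul (i j : Fin n) (z w : FominKirillov k n ⊗[k] FominKirillov k n) :
    braidedMul k n (leftMul i j z ⊗ₜ w) = leftMul i j (braidedMul k n (z ⊗ₜ w)) := by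
  induction w with
  | zero => simp
  | add a b ha hb => simp only [TensorProduct.tmul_add, map_add, ha, hb]
  | tmul c d =>
    have : braidedMul k n ∘ₗ (TensorProduct.mk k _ _).flip (c ⊗ₜ d) ∘ₗ leftMul i j =
        leftMul i j ∘ₗ braidedMul k n ∘ₗ (TensorProduct.mk k _ _).flip (c ⊗ₜ d) :=
      ext_mono₂ fun u v => by
        simp only [LinearMap.comp_apply, LinearMap.flip_apply, TensorProduct.mk_apply,
          leftMul_tmul, map_add]
        rw [← mono_cons (i, j) v]
        rw [braidedMul_mono, braidedMul_mono, braidedMul_mono, leftMul_tmul, deg_cons, map_mul,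
          act_mul_apply, mono_cons]
        simp only [mul_assoc]
    exact congrArg (fun f => f z) this

theorem comul_mul (a b : FominKirillov k n) :
    comul k n (a * b) = braidedMul k n (comul k n a ⊗ₜ comul k n b) := by
  have : comul k n ∘ₗ (LinearMap.mul k _).flip b =
      braidedMul k n ∘ₗ (TensorProduct.mk k _ _).flip (comul k n b) ∘ₗ comul k n :=
    ext_mono fun w => by
      simp only [LinearMap.comp_apply, LinearMap.flip_apply, TensorProduct.mk_apply,
        LinearMap.mul_apply']
      induction w with
      | nil => rw [mono_nil, one_mul, comul_one, braidedMul_one]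
      | cons p w ih =>
        rw [mono_cons, mul_assoc, comul_x_mul, ih, comul_x_mul, leftMul_braidedMul]
  exact congrArg (fun f => f a) this

theorem comul_act (g : Equiv.Perm (Fin n)) :
    comul k n ∘ₗ (act g).toLinearMap =
      TensorProduct.map (act g).toLinearMap (act g).toLinearMap ∘ₗ comul k n :=
  ext_mono fun w => by
    have hcomm : ∀ i j z, leftMul (k := k) (g i) (g j)
        (TensorProduct.map (act g).toLinearMap (act g).toLinearMap z) =
        TensorProduct.map (act g).toLinearMap (act g).toLinearMap (leftMul i j z) := by
      intro i j z
      induction z with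
      | zero => simp
      | add a b ha hb => simp only [map_add, ha, hb]
      | tmul a b =>
        simp only [TensorProduct.map_tmul, leftMul_tmul, map_add, AlgHom.toLinearMap_apply,
          map_mul, act_x, act_mul_apply, Equiv.swap_apply_apply]
        simp [mul_assoc]
    simp only [LinearMap.comp_apply, AlgHom.toLinearMap_apply]
    induction w with
    | nil => simp [mono_nil, comul_one]
    | cons p w ih => rw [mono_cons, map_mul, act_x, comul_x_mul, ih, hcomm, comul_x_mul]

theorem tensor_proj_mono (g : Equiv.Perm (Fin n)) (v w : List (Fin n × Fin n)) :
    ((yd k n).tensor (yd k n)).proj g (mono k v ⊗ₜ mono k w) =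
      if g = deg v * deg w then mono k v ⊗ₜ mono k w else 0 := by
  change (∑ a, TensorProduct.map (proj a) (proj (a⁻¹ * g))) _ = _
  simp only [LinearMap.sum_apply, TensorProduct.map_tmul]
  rw [Finset.sum_eq_single (deg v)]
  · simp only [proj_mono, inv_mul_eq_iff_eq_mul, if_true]
    split_ifs <;> simp
  · intro a _ ha
    rw [proj_mono, if_neg ha, TensorProduct.zero_tmul]
  · simp

theorem tensor_proj_leftMul (g : Equiv.Perm (Fin n)) (i j : Fin n)
    (z : FominKirillov k n ⊗[k] FominKirillov k n) :
    ((yd k n).tensor (yd k n)).proj (Equiv.swap i j * g) (leftMul i j z) =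
      leftMul i j (((yd k n).tensor (yd k n)).proj g z) := by
  have : ((yd k n).tensor (yd k n)).proj (Equiv.swap i j * g) ∘ₗ leftMul i j =
      leftMul i j ∘ₗ ((yd k n).tensor (yd k n)).proj g := ext_mono₂ fun v w => by
    rw [LinearMap.comp_apply, LinearMap.comp_apply, tensor_proj_mono, leftMul_tmul,
      ← mono_cons (i, j) v, ← mono_cons (i, j) w, act_mono, map_add, tensor_proj_mono,
      tensor_proj_mono, deg_map, deg_cons, deg_cons]
    have e₁ : Equiv.swap i j * g = Equiv.swap i j * deg v * deg w ↔ g = deg v * deg w := by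
      rw [mul_assoc, mul_right_inj]
    have e₂ : Equiv.swap i j * g = Equiv.swap i j * deg v * (Equiv.swap i j)⁻¹ *
        (Equiv.swap i j * deg w) ↔ g = deg v * deg w := by
      rw [mul_assoc (Equiv.swap i j * deg v), inv_mul_cancel_left, mul_assoc, mul_right_inj]
    simp only [e₁, e₂]
    split_ifs
    · rw [leftMul_tmul, act_mono, ← mono_cons (i, j) v, ← mono_cons (i, j) w]
    · simp
  exact congrArg (fun f => f z) this

theorem comul_proj (g : Equiv.Perm (Fin n)) :
    comul k n ∘ₗ proj g = ((yd k n).tensor (yd k n)).proj g ∘ₗ comul k n :=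
  ext_mono fun w => by
    simp only [LinearMap.comp_apply]
    induction w generalizing g with
    | nil =>
      rw [mono_nil, comul_one, ← mono_nil, tensor_proj_mono, proj_mono, deg_nil, mul_one]
      split_ifs
      · rw [mono_nil, comul_one]
      · simp
    | cons p w ih =>
      obtain ⟨h, rfl⟩ : ∃ h, g = Equiv.swap p.1 p.2 * h :=
        ⟨(Equiv.swap p.1 p.2)⁻¹ * g, by simp⟩
      rw [mono_cons, comul_x_mul, tensor_proj_leftMul, ← ih, ← mono_cons, proj_mono, proj_mono,
        deg_cons]
      simp only [mul_right_inj]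
      split_ifs
      · rw [mono_cons, comul_x_mul]
      · simp

theorem isYetterDrinfeld : (data k n).IsYetterDrinfeld (yd k n) where
  mul :=
    { act := fun g => TensorProduct.ext' fun a b => (map_mul (act g) a b).symm
      proj := fun g => ext_mono₂ fun v w => by
        rw [LinearMap.comp_apply, LinearMap.comp_apply, tensor_proj_mono]
        change _ = proj g (mono k v * mono k w)
        rw [← mono_append, proj_mono, deg_append]
        split_ifs
        · exact (mono_append v w).symm
        · simp }
  unit :=
    { act := fun g => by
        ext
        change algebraMap k _ 1 = act g (algebraMap k _ 1)
        simp
      proj := fun g => by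
        ext
        change algebraMap k (FominKirillov k n) ((YetterDrinfeld.unit k _).proj g 1) =
          proj g (algebraMap k _ 1)
        rw [map_one (algebraMap k (FominKirillov k n)), ← mono_nil, proj_mono, deg_nil]
        by_cases h : g = 1
        · subst h; simp [YetterDrinfeld.unit_proj_one, mono_nil]
        · simp [YetterDrinfeld.unit_proj_ne h, h] }
  comul := { act := comul_act, proj := comul_proj }
  counit :=
    { act := fun g => ext_mono fun w => by
        change counit k n (act g (mono k w)) = counit k n (mono k w)
        rw [act_mono]
        cases w with
        | nil => rfl
        | cons p w => simp [mono_cons, counit_x]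
      proj := fun g => ext_mono fun w => by
        change counit k n (proj g (mono k w)) =
          (YetterDrinfeld.unit k _).proj g (counit k n (mono k w))
        rw [proj_mono]
        cases w with
        | nil =>
          by_cases h : g = 1
          · subst h; simp [YetterDrinfeld.unit_proj_one, deg_nil]
          · simp [YetterDrinfeld.unit_proj_ne h, h, deg_nil]
        | cons p w => split_ifs <;> simp [mono_cons, counit_x] }

/-- Left multiplication by `x ⊗ 1 ⊗ 1 + 1 ⊗ x ⊗ 1 + 1 ⊗ 1 ⊗ x`, for `x = x_(ij)`. -/
def leftMul₃ (i j : Fin n) :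
    Module.End k ((FominKirillov k n ⊗[k] FominKirillov k n) ⊗[k] FominKirillov k n) :=
  TensorProduct.map (leftMul i j) LinearMap.id +
    TensorProduct.map (TensorProduct.map (act (Equiv.swap i j)).toLinearMap
      (act (Equiv.swap i j)).toLinearMap) (LinearMap.mulLeft k (x k i j))

/-- The same operator with the other bracketing. -/
def leftMul₃' (i j : Fin n) :
    Module.End k (FominKirillov k n ⊗[k] (FominKirillov k n ⊗[k] FominKirillov k n)) :=
  TensorProduct.map (LinearMap.mulLeft k (x k i j)) LinearMap.id +
    TensorProduct.map (act (Equiv.swap i j)).toLinearMap (leftMul i j)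

theorem coassoc :
    (TensorProduct.assoc k _ _ _).toLinearMap ∘ₗ LinearMap.rTensor _ (comul k n) ∘ₗ comul k n =
      LinearMap.lTensor _ (comul k n) ∘ₗ comul k n := by
  have h₁ : ∀ (i j : Fin n) (z : FominKirillov k n ⊗[k] FominKirillov k n),
      LinearMap.rTensor _ (comul k n) (leftMul i j z) =
        leftMul₃ i j
        (LinearMap.rTensor _ (comul k n) z) := by
    intro i j z
    induction z with
    | zero => simp
    | add a b ha hb => simp only [map_add, ha, hb]
    | tmul a b =>
      have := congrArg (fun f => f a) (comul_act (k := k) (Equiv.swap i j))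
      simp only [LinearMap.comp_apply, AlgHom.toLinearMap_apply] at this
      simp [leftMul₃, leftMul_tmul, comul_x_mul, this]
  have h₂ : ∀ (i j : Fin n) (z : FominKirillov k n ⊗[k] FominKirillov k n),
      LinearMap.lTensor _ (comul k n) (leftMul i j z) =
        leftMul₃' i j
        (LinearMap.lTensor _ (comul k n) z) := by
    intro i j z
    induction z with
    | zero => simp
    | add a b ha hb => simp only [map_add, ha, hb]
    | tmul a b => simp [leftMul₃', leftMul_tmul, comul_x_mul]
  have h₃ : ∀ (i j : Fin n)
      (z : (FominKirillov k n ⊗[k] FominKirillov k n) ⊗[k] FominKirillov k n),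
      (TensorProduct.assoc k _ _ _) (leftMul₃ i j z) =
      leftMul₃' i j
        (TensorProduct.assoc k _ _ _ z) := by
    intro i j z
    induction z with
    | zero => simp
    | add a b ha hb => simp only [map_add, ha, hb]
    | tmul z c =>
      induction z with
      | zero => simp
      | add a b ha hb => simp only [TensorProduct.add_tmul, map_add, ha, hb]
      | tmul a b =>
        simp [leftMul₃, leftMul₃', leftMul_tmul, TensorProduct.add_tmul, TensorProduct.tmul_add]
        abel
  refine ext_mono fun w => ?_
  simp only [LinearMap.comp_apply, LinearEquiv.coe_coe]
  induction w with
  | nil => simp [mono_nil, comul_one]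
  | cons p w ih => rw [mono_cons, comul_x_mul, h₁, h₃, ih, h₂]

theorem isBialgebra : (data k n).IsBialgebra ((yd k n).braiding (yd k n)) where
  mul_assoc := by ext; simp [data, mul_assoc]
  unit_mul := by ext; simp [data]
  mul_unit := by ext; simp [data]
  comul_coassoc := coassoc
  counit_comul := ext_mono fun w => by
    simp only [LinearMap.comp_apply, LinearEquiv.coe_coe]
    change LinearMap.rTensor _ (counit k n).toLinearMap (comul k n _) = _
    induction w with
    | nil => simp [mono_nil, comul_one]
    | cons p w ih =>
      have : ∀ z, LinearMap.rTensor (FominKirillov k n) (counit k n).toLinearMap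
          (leftMul p.1 p.2 z) = LinearMap.lTensor k (LinearMap.mulLeft k (x k p.1 p.2))
          (LinearMap.rTensor _ (counit k n).toLinearMap z) := by
        intro z
        have : LinearMap.rTensor (FominKirillov k n) (counit k n).toLinearMap ∘ₗ
          (leftMul p.1 p.2) = LinearMap.lTensor k (LinearMap.mulLeft k (x k p.1 p.2)) ∘ₗ
          (LinearMap.rTensor _ (counit k n).toLinearMap) := ext_mono₂ fun u v => by
            have e := congrArg (fun f => f (mono k u))
              ((isYetterDrinfeld (k := k) (n := n)).counit.act (Equiv.swap p.1 p.2))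
            have e' : counit k n (act (Equiv.swap p.1 p.2) (mono k u)) =
              counit k n (mono k u) := e
            simp [leftMul_tmul, counit_x, e']
        exact congrArg (fun f => f z) this
      rw [mono_cons, comul_x_mul, this, ih]
      simp
  comul_counit := ext_mono fun w => by
    simp only [LinearMap.comp_apply, LinearEquiv.coe_coe]
    change LinearMap.lTensor _ (counit k n).toLinearMap (comul k n _) = _
    induction w with
    | nil => simp [mono_nil, comul_one]
    | cons p w ih =>
      have : ∀ z, LinearMap.lTensor (FominKirillov k n) (counit k n).toLinearMap
          (leftMul p.1 p.2 z) = LinearMap.rTensor k (LinearMap.mulLeft k (x k p.1 p.2))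
          (LinearMap.lTensor _ (counit k n).toLinearMap z) := by
        intro z
        have : LinearMap.lTensor (FominKirillov k n) (counit k n).toLinearMap ∘ₗ
          (leftMul p.1 p.2) = LinearMap.rTensor k (LinearMap.mulLeft k (x k p.1 p.2)) ∘ₗ
          (LinearMap.lTensor _ (counit k n).toLinearMap) := ext_mono₂ fun u v => by
            simp [leftMul_tmul, counit_x]
        exact congrArg (fun f => f z) this
      rw [mono_cons, comul_x_mul, this, ih]
      simp
  comul_mul := TensorProduct.ext' fun a b => comul_mul a b
  comul_unit := by
    change comul k n (algebraMap k _ 1) = algebraMap k _ 1 ⊗ₜ algebraMap k _ 1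
    rw [map_one, comul_one]
  counit_mul := TensorProduct.ext' fun a b => by simp [data]
  counit_unit := by ext; simp [data]

/-- The algebra homomorphism `FK_n → FK_n[X]` with `x_(ij) ↦ x_(ij) X`. -/
def gradeHom (k : Type*) [CommRing k] (n : ℕ) :
    FominKirillov k n →ₐ[k] Polynomial (FominKirillov k n) :=
  lift (fun i j => Polynomial.monomial 1 (x k i j))
    { self := fun _ => by rw [x_self, map_zero]
      anti := fun i j => by rw [x_anti, map_neg]
      sq := fun i j _ => by rw [Polynomial.monomial_mul_monomial, x_sq, map_zero]
      cyc := fun i j l a b c => by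
        simp only [Polynomial.monomial_mul_monomial]
        rw [← map_add, ← map_add, x_cyc i j l a b c, map_zero]
      comm := fun i j l m h₁ h₂ a b c d => by
        simp only [Polynomial.monomial_mul_monomial]
        rw [x_comm i j l m a b c d] }

theorem gradeHom_mono (w : List (Fin n × Fin n)) :
    gradeHom k n (mono k w) = Polynomial.monomial w.length (mono k w) := by
  induction w with
  | nil => rw [mono_nil, map_one]; rfl
  | cons p w ih =>
    rw [mono_cons, map_mul, ih, gradeHom, lift_x, Polynomial.monomial_mul_monomial,
      List.length_cons, add_comm]

theorem gradeHom_of_mem {d : ℕ} {b : FominKirillov k n} (hb : b ∈ gr k n d) :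
    gradeHom k n b = Polynomial.monomial d b := by
  induction hb using Submodule.span_induction with
  | mem b h => obtain ⟨w, rfl, rfl⟩ := h; exact gradeHom_mono w
  | zero => simp
  | add a b _ _ ha hb => rw [map_add, ha, hb, map_add]
  | smul r a _ ha => rw [map_smul, ha, Polynomial.smul_monomial]

theorem isInternal : DirectSum.IsInternal (gr k n) := by
  constructor
  · rw [injective_iff_map_eq_zero]
    intro z hz
    have key : ∀ (z : DirectSum ℕ fun d => gr k n d) (d : ℕ),
        (gradeHom k n (DirectSum.coeAddMonoidHom (gr k n) z)).coeff d = z d := by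
      intro z d
      induction z using DirectSum.induction_on with
      | zero => simp
      | of e b =>
        rw [DirectSum.coeAddMonoidHom_of, gradeHom_of_mem b.2, Polynomial.coeff_monomial]
        split_ifs with h
        · subst h; simp
        · rw [DirectSum.of_eq_of_ne _ _ _ (Ne.symm h)]; rfl
      | add a b ha hb => simp [ha, hb]
    ext d
    rw [← key z d, hz]; simp
  · intro b
    have hb : b ∈ Submodule.span k (Set.range (mono k (n := n))) := by
      rw [span_mono]; trivial
    induction hb using Submodule.span_induction with
    | mem b h =>
      obtain ⟨w, rfl⟩ := h
      exact ⟨DirectSum.of (fun d => gr k n d) w.length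
        ⟨mono k w, Submodule.subset_span ⟨w, rfl, rfl⟩⟩, DirectSum.coeAddMonoidHom_of _ _ _⟩
    | zero => exact ⟨0, map_zero _⟩
    | add a b _ _ ha hb =>
      obtain ⟨u, rfl⟩ := ha
      obtain ⟨v, rfl⟩ := hb
      exact ⟨u + v, map_add _ _ _⟩
    | smul r a _ ha =>
      obtain ⟨u, rfl⟩ := ha
      exact ⟨r • u, (DirectSum.coeLinearMap (gr k n)).map_smul r u⟩

theorem mono_mem_gr (w : List (Fin n × Fin n)) : mono k w ∈ gr k n w.length :=
  Submodule.subset_span ⟨w, rfl, rfl⟩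

theorem act_mem (g : Equiv.Perm (Fin n)) (d : ℕ) : ∀ b ∈ gr k n d, act g b ∈ gr k n d := by
  intro b hb
  induction hb using Submodule.span_induction with
  | mem b h =>
    obtain ⟨w, rfl, rfl⟩ := h
    rw [act_mono]
    exact Submodule.subset_span ⟨_, by simp, rfl⟩
  | zero => simp
  | add a b _ _ ha hb => rw [map_add]; exact add_mem ha hb
  | smul r a _ ha => rw [map_smul]; exact Submodule.smul_mem _ _ ha

theorem proj_mem (g : Equiv.Perm (Fin n)) (d : ℕ) : ∀ b ∈ gr k n d, proj g b ∈ gr k n d := by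
  intro b hb
  induction hb using Submodule.span_induction with
  | mem b h =>
    obtain ⟨w, rfl, rfl⟩ := h
    rw [proj_mono]
    split_ifs
    · exact mono_mem_gr w
    · exact zero_mem _
  | zero => simp
  | add a b _ _ ha hb => rw [map_add]; exact add_mem ha hb
  | smul r a _ ha => rw [map_smul]; exact Submodule.smul_mem _ _ ha

theorem mul_mem_gr {d e : ℕ} {a b : FominKirillov k n} (ha : a ∈ gr k n d) (hb : b ∈ gr k n e) :
    a * b ∈ gr k n (d + e) := by
  have := Submodule.mul_mem_mul ha hb
  rw [gr, gr, Submodule.span_mul_span] at this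
  refine Submodule.span_mono ?_ this
  rintro _ ⟨_, ⟨v, rfl, rfl⟩, _, ⟨w, rfl, rfl⟩, rfl⟩
  exact ⟨v ++ w, by simp, (mono_append v w).symm⟩

theorem leftMul_mem (i j : Fin n) (d : ℕ) (z : FominKirillov k n ⊗[k] FominKirillov k n)
    (hz : z ∈ tensorGrading k (fun d => (gr k n d).toAddSubgroup)
      (fun d => (gr k n d).toAddSubgroup) d) :
    leftMul i j z ∈ tensorGrading k (fun d => (gr k n d).toAddSubgroup)
      (fun d => (gr k n d).toAddSubgroup) (d + 1) := by
  have hx : x k i j ∈ gr k n 1 := by simpa [mono_cons, mono_nil] using mono_mem_gr (k := k) [(i, j)]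
  induction hz using AddSubgroup.closure_induction with
  | mem z h =>
    obtain ⟨p, q, rfl, a, ha, b, hb, rfl⟩ := h
    rw [leftMul_tmul]
    refine add_mem (AddSubgroup.subset_closure ⟨1 + p, q, by ring, _, mul_mem_gr hx ha, _, hb, rfl⟩)
      (AddSubgroup.subset_closure
        ⟨p, 1 + q, by ring, _, act_mem _ _ _ ha, _, mul_mem_gr hx hb, rfl⟩)
  | zero => simp
  | add a b _ _ ha hb => rw [map_add]; exact add_mem ha hb
  | neg a _ ha => rw [map_neg]; exact neg_mem ha

theorem smul_mem_tensorGrading (r : k) (d : ℕ) (z : FominKirillov k n ⊗[k] FominKirillov k n)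
    (hz : z ∈ tensorGrading k (fun d => (gr k n d).toAddSubgroup)
      (fun d => (gr k n d).toAddSubgroup) d) :
    r • z ∈ tensorGrading k (fun d => (gr k n d).toAddSubgroup)
      (fun d => (gr k n d).toAddSubgroup) d := by
  induction hz using AddSubgroup.closure_induction with
  | mem z h =>
    obtain ⟨p, q, rfl, a, ha, b, hb, rfl⟩ := h
    exact AddSubgroup.subset_closure
      ⟨p, q, rfl, r • a, Submodule.smul_mem _ r ha, b, hb, TensorProduct.smul_tmul' r a b⟩
  | zero => simp
  | add a b _ _ ha hb => rw [smul_add]; exact add_mem ha hb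
  | neg a _ ha => rw [smul_neg]; exact neg_mem ha

theorem isGraded : (data k n).IsGraded (scalarGrading k) (fun d => (gr k n d).toAddSubgroup) where
  mul d z hz := by
    induction hz using AddSubgroup.closure_induction with
    | mem z h =>
      obtain ⟨p, q, rfl, a, ha, b, hb, rfl⟩ := h
      exact mul_mem_gr ha hb
    | zero => simp
    | add a b _ _ ha hb => rw [map_add]; exact add_mem ha hb
    | neg a _ ha => rw [map_neg]; exact neg_mem ha
  unit d r hr := by
    change algebraMap k _ r ∈ gr k n d
    by_cases h : d = 0
    · subst h
      rw [Algebra.algebraMap_eq_smul_one]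
      exact Submodule.smul_mem _ _ (mono_mem_gr [])
    · have : r = 0 := by simpa [scalarGrading, h] using hr
      simp [this]
  comul d b hb := by
    change comul k n b ∈ _
    change b ∈ gr k n d at hb
    induction hb using Submodule.span_induction with
    | mem b h =>
      obtain ⟨w, rfl, rfl⟩ := h
      induction w with
      | nil =>
        rw [mono_nil, comul_one]
        exact AddSubgroup.subset_closure
          ⟨0, 0, rfl, 1, mono_mem_gr [], 1, mono_mem_gr [], rfl⟩
      | cons p w ih => rw [mono_cons, comul_x_mul]; exact leftMul_mem _ _ _ _ ih
    | zero => simp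
    | add a b _ _ ha hb => rw [map_add]; exact add_mem ha hb
    | smul r a _ ha => rw [map_smul]; exact smul_mem_tensorGrading _ _ _ ha
  counit d b hb := by
    change counit k n b ∈ _
    by_cases h : d = 0
    · simp [scalarGrading, h]
    · change b ∈ gr k n d at hb
      have : counit k n b = 0 := by
        induction hb using Submodule.span_induction with
        | mem b hb =>
          obtain ⟨w, rfl, rfl⟩ := hb
          cases w with
          | nil => simp at h
          | cons p w => simp [mono_cons, counit_x]
        | zero => simp
        | add a b _ _ ha hb => rw [map_add, ha, hb, add_zero]
        | smul r a _ ha => rw [map_smul, ha, smul_zero]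
      rw [this]; exact zero_mem _

/-- `FK_n` as a graded bialgebra in the category of Yetter-Drinfeld modules over `S_n`. -/
def gradedBialgebra (k : Type*) [CommRing k] (n : ℕ) :
    GradedYDBialgebra k (Equiv.Perm (Fin n)) (FominKirillov k n) where
  yd := yd k n
  data := data k n
  gr := gr k n
  isInternal := isInternal
  act_mem := act_mem
  proj_mem := proj_mem
  isBialgebra := isBialgebra
  isYetterDrinfeld := isYetterDrinfeld
  isGraded := isGraded

end FominKirillov

end

/-! The relations of `FK_n` are quadratic, and a graded deformation with `t` in degree 1 has no room
to change them. Evaluate such a relation with the deformed product. The result has degree 2, so it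
is `c₀ + t c₁ + t² c₂` with `c_s` of degree `2 - s`. Here `c₀ = 0`, because the relation holds at `t
= 0`. Each relation is homogeneous for the coaction and lies over an even permutation, while degree
1 of `FK_n` lies over transpositions, so `c₁ = 0`. Finally `c₂` is a scalar and the counit detects
it. The counit kills each generator, whose coaction degree is not 1, hence every product of two
generators, so `c₂ = 0`. This is `eq_zero_of_mem_grT_two`, and `isFK_deformationLeftMul` applies it
to all relations.

Thus there is a map `φ` from `FK_n` to `FK_n[t]` that is multiplicative for the deformed product and
fixes the generators (`deformationLift`). Degree reasons and the counit axioms force the generators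
to remain primitive (`deformation_comul_xT`), so `φ` also respects the comultiplication
(`comul_deformationLift`). It is graded, a morphism of Yetter–Drinfeld modules and the identity
modulo `t`. Its `k[t]`-linear extension is surjective by induction on the degree, since `φ(b) - b`
involves only components of lower degree in `FK_n` (`exists_deformationHom_eq`). It is injective
because a kernel element can be divided by `t` repeatedly (`deformationHom_injective`). The inverse
is the required equivalence.

The braided statement reduces to this one. A map that commutes with the braidings with `FK_n[t]` is
a morphism of Yetter–Drinfeld modules (`isHom_of_commutes`): the action on `FK_n[t]` is faithful,
which recovers the coaction, and the degrees of the nonzero generators are the transpositions, which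
generate `S_n`, which recovers the action. Conversely, morphisms of Yetter–Drinfeld modules commute
with braidings by naturality. -/

theorem TensorProduct.eq_zero_or_eq_zero_of_tmul_eq_zero {R M N : Type*} [CommRing R] [IsDomain R]
    [AddCommGroup M] [Module R M] [Module.Free R M] [AddCommGroup N] [Module R N] [Module.Free R N]
    {a : M} {b : N} (h : a ⊗ₜ[R] b = 0) : a = 0 ∨ b = 0 := by
  by_contra! hab
  let u := Module.Free.chooseBasis R M
  let v := Module.Free.chooseBasis R N
  obtain ⟨i, hi⟩ : ∃ i, u.coord i a ≠ 0 := by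
    by_contra! hi
    exact hab.1 (u.ext_elem fun i => by simpa using hi i)
  obtain ⟨j, hj⟩ : ∃ j, v.coord j b ≠ 0 := by
    by_contra! hj
    exact hab.2 (v.ext_elem fun j => by simpa using hj j)
  -- A pair of coordinate functionals, one nonzero on `a` and one on `b`, sends `a ⊗ b` to a product
  -- of nonzero elements of a domain.
  have := congrArg (fun z => TensorProduct.lid R R (TensorProduct.map (u.coord i) (v.coord j) z)) h
  simp only [TensorProduct.map_tmul, TensorProduct.lid_tmul, smul_eq_mul, map_zero] at this
  exact mul_ne_zero hi hj this

/-! ### Braidings of Yetter–Drinfeld modules, and morphisms recovered from them -/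

namespace YetterDrinfeld

variable {R G M N P : Type*} [CommRing R] [Group G] [Fintype G]
  [AddCommGroup M] [Module R M] [AddCommGroup N] [Module R N] [AddCommGroup P] [Module R P]

theorem braiding_tmul (Y : YetterDrinfeld R G M) (Z : YetterDrinfeld R G N) (a : M) (b : N) :
    Y.braiding Z (a ⊗ₜ b) = ∑ g, Z.act g b ⊗ₜ Y.proj g a := by
  simp [braiding, LinearMap.sum_apply]

theorem proj_proj [DecidableEq G] (Y : YetterDrinfeld R G M) (g h : G) (a : M) :
    Y.proj g (Y.proj h a) = if g = h then Y.proj h a else 0 := by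
  split_ifs with e
  · subst e; exact congrArg (fun f => f a) (Y.proj_self g)
  · exact congrArg (fun f => f a) (Y.proj_ne g h e)

theorem sum_proj_apply (Y : YetterDrinfeld R G M) (a : M) : ∑ g, Y.proj g a = a := by
  have := congrArg (fun f => f a) Y.sum_proj
  simpa [LinearMap.sum_apply] using this

theorem braiding_tmul_of_proj (Y : YetterDrinfeld R G M) (Z : YetterDrinfeld R G N) {g : G} {a : M}
    (ha : Y.proj g a = a) (b : N) : Y.braiding Z (a ⊗ₜ b) = Z.act g b ⊗ₜ a := by
  classical
  rw [braiding_tmul, Finset.sum_eq_single g]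
  · rw [ha]
  · intro h _ hg
    rw [← ha, proj_proj, if_neg hg, TensorProduct.tmul_zero]
  · simp

theorem tensor_act_tmul (Y : YetterDrinfeld R G M) (Z : YetterDrinfeld R G N) (g : G)
    (a : M) (b : N) : (Y.tensor Z).act g (a ⊗ₜ b) = Y.act g a ⊗ₜ Z.act g b := rfl

theorem tensor_proj_tmul (Y : YetterDrinfeld R G M) (Z : YetterDrinfeld R G N) (g : G)
    (a : M) (b : N) :
    (Y.tensor Z).proj g (a ⊗ₜ b) = ∑ h, Y.proj h a ⊗ₜ Z.proj (h⁻¹ * g) b := by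
  simp [tensor, LinearMap.sum_apply]

theorem tensor_proj_tmul_of_proj (Y : YetterDrinfeld R G M) (Z : YetterDrinfeld R G N) {g h : G}
    {a : M} {b : N} (ha : Y.proj g a = a) (hb : Z.proj h b = b) :
    (Y.tensor Z).proj (g * h) (a ⊗ₜ b) = a ⊗ₜ b := by
  classical
  rw [tensor_proj_tmul, Finset.sum_eq_single g]
  · rw [inv_mul_cancel_left, ha, hb]
  · intro l _ hl
    rw [← ha, proj_proj, if_neg hl, TensorProduct.zero_tmul]
  · simp

/-- One hexagon identity: the coaction degree of `a ⊗ b` is the product of the two degrees. With its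
mirror image below and the two unit lemmas, it turns each axiom of `CommutesWith` into commutation
of a single map with the braidings of its source and target. -/
theorem braidingLeft_braiding (Y : YetterDrinfeld R G M) :
    braidingLeft (Y.braiding Y) = (Y.tensor Y).braiding Y := by
  refine TensorProduct.ext_threefold fun a b c => ?_
  simp only [braidingLeft, LinearMap.comp_apply, LinearEquiv.coe_coe, TensorProduct.assoc_tmul,
    LinearMap.lTensor_tmul, braiding_tmul, TensorProduct.tmul_sum, map_sum,
    TensorProduct.assoc_symm_tmul, LinearMap.rTensor_tmul, TensorProduct.sum_tmul,
    tensor_proj_tmul]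
  rw [Finset.sum_comm]
  conv_rhs => rw [Finset.sum_comm]
  refine Finset.sum_congr rfl fun g _ => ?_
  refine Fintype.sum_equiv (Equiv.mulLeft g) _ _ fun h => ?_
  simp

/-- The other hexagon identity: the group acts diagonally on the tensor square. Both applications of
`c` see the same homogeneous component of `a`, so the double sum collapses to its diagonal. -/
theorem braidingRight_braiding (Y : YetterDrinfeld R G M) :
    braidingRight (Y.braiding Y) = Y.braiding (Y.tensor Y) := by
  classical
  refine TensorProduct.ext' fun a z => ?_
  induction z with
  | zero => simp
  | add u v hu hv => simp only [TensorProduct.tmul_add, map_add, hu, hv]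
  | tmul b c =>
    simp only [braidingRight, LinearMap.comp_apply, LinearEquiv.coe_coe, TensorProduct.assoc_tmul,
      LinearMap.lTensor_tmul, braiding_tmul, TensorProduct.tmul_sum, map_sum,
      TensorProduct.assoc_symm_tmul, LinearMap.rTensor_tmul, TensorProduct.sum_tmul,
      tensor_act_tmul, proj_proj]
    refine Finset.sum_congr rfl fun g _ => ?_
    rw [Finset.sum_eq_single g]
    · simp
    · intro h _ hg; simp [hg]
    · simp

theorem unit_braiding (Y : YetterDrinfeld R G M) :
    (unit R G).braiding Y = (TensorProduct.comm R R M).toLinearMap :=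
  TensorProduct.ext' fun a b => by
    rw [braiding_tmul_of_proj (g := 1) _ _ (by rw [unit_proj_one]; rfl)]
    simp

theorem braiding_unit (Y : YetterDrinfeld R G M) :
    Y.braiding (unit R G) = (TensorProduct.comm R M R).toLinearMap :=
  TensorProduct.ext' fun a b => by
    rw [braiding_tmul]
    change ∑ g, b ⊗ₜ Y.proj g a = _
    rw [← TensorProduct.tmul_sum, sum_proj_apply]
    simp

/-- Naturality in the first variable, which uses only compatibility with the coaction; naturality in
the second uses only the action. -/
theorem IsHom.braiding_left {Y : YetterDrinfeld R G M} {Z : YetterDrinfeld R G N} {f : M →ₗ[R] N}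
    (hf : Y.IsHom Z f) (W : YetterDrinfeld R G P) :
    Z.braiding W ∘ₗ LinearMap.rTensor P f = LinearMap.lTensor P f ∘ₗ Y.braiding W :=
  TensorProduct.ext' fun a b => by
    have := fun g => congrArg (fun f => f a) (hf.proj g)
    simp only [LinearMap.comp_apply] at this
    simp [braiding_tmul, this]

theorem IsHom.braiding_right {Y : YetterDrinfeld R G M} {Z : YetterDrinfeld R G N} {f : M →ₗ[R] N}
    (hf : Y.IsHom Z f) (W : YetterDrinfeld R G P) :
    W.braiding Z ∘ₗ LinearMap.lTensor P f = LinearMap.rTensor P f ∘ₗ W.braiding Y :=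
  TensorProduct.ext' fun a b => by
    have := fun g => congrArg (fun f => f b) (hf.act g)
    simp only [LinearMap.comp_apply] at this
    simp [braiding_tmul, this]

/-- If `W` is faithful, a map commuting with the braidings with `W` on the right preserves the
coaction. -/
theorem comp_proj_of_braiding_left [IsDomain R] [Module.Free R P] [Module.Free R N]
    {Y : YetterDrinfeld R G M} {Z : YetterDrinfeld R G N} {f : M →ₗ[R] N}
    {W : YetterDrinfeld R G P} (hW : Function.Injective W.act)
    (hf : Z.braiding W ∘ₗ LinearMap.rTensor P f = LinearMap.lTensor P f ∘ₗ Y.braiding W) (g : G) :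
    f ∘ₗ Y.proj g = Z.proj g ∘ₗ f := by
  classical
  have key : ∀ (h : G) (a : M), Y.proj h a = a → ∀ l, l ≠ h → Z.proj l (f a) = 0 := by
    intro h a ha l hl
    -- Faithfulness separates `l` from `h` on some vector `b`.
    obtain ⟨b, hb⟩ : ∃ b, W.act l b - W.act h b ≠ 0 := by
      by_contra! hb
      exact hl (hW (LinearMap.ext fun b => sub_eq_zero.1 (hb b)))
    -- Evaluating at `a ⊗ b` and projecting the second factor to degree `l` gives `l·b ⊗ f(a)_l =
    -- h·b ⊗ f(a)_l`. Since `l·b ≠ h·b`, the component `f(a)_l` vanishes.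
    have e := congrArg (fun u => LinearMap.lTensor P (Z.proj l) (u (a ⊗ₜ b))) hf
    simp only [LinearMap.comp_apply, LinearMap.rTensor_tmul, braiding_tmul_of_proj Y W ha,
      LinearMap.lTensor_tmul, braiding_tmul, map_sum, proj_proj] at e
    rw [Finset.sum_eq_single l (fun m _ hm => by simp [hm.symm]) (by simp), if_pos rfl,
      ← sub_eq_zero, ← TensorProduct.sub_tmul] at e
    exact (TensorProduct.eq_zero_or_eq_zero_of_tmul_eq_zero e).resolve_left hb
  refine LinearMap.ext fun a => ?_
  simp only [LinearMap.comp_apply]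
  conv_rhs => rw [← Y.sum_proj_apply a, map_sum, map_sum]
  rw [Finset.sum_eq_single g]
  · conv_lhs => rw [← Z.sum_proj_apply (f (Y.proj g a))]
    rw [Finset.sum_eq_single g]
    · intro l _ hl; exact key g _ (by simp [proj_proj]) l hl
    · simp
  · intro h _ hh; exact key h _ (by simp [proj_proj]) g hh.symm
  · simp

/-- If `f` commutes with the braidings with `W` on the left, then it commutes with the action of
the elements `g` with `W_g ≠ 0`. -/
theorem comp_act_of_braiding_right [IsDomain R] [Module.Free R P] [Module.Free R N]
    {Y : YetterDrinfeld R G M} {Z : YetterDrinfeld R G N} {f : M →ₗ[R] N}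
    {W : YetterDrinfeld R G P}
    (hf : W.braiding Z ∘ₗ LinearMap.lTensor P f = LinearMap.rTensor P f ∘ₗ W.braiding Y)
    {g : G} {b : P} (hb : W.proj g b = b) (hb0 : b ≠ 0) :
    f ∘ₗ Y.act g = Z.act g ∘ₗ f := by
  refine LinearMap.ext fun a => ?_
  -- As `b` is homogeneous of degree `g`, both braidings reduce to one term: `g·f(a) ⊗ b = f(g·a) ⊗
  -- b`, and `b ≠ 0` can be cancelled.
  have e := congrArg (fun u => u (b ⊗ₜ a)) hf
  simp only [LinearMap.comp_apply, LinearMap.rTensor_tmul, braiding_tmul_of_proj W _ hb,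
      LinearMap.lTensor_tmul] at e
  rw [← sub_eq_zero, ← TensorProduct.sub_tmul] at e
  exact (sub_eq_zero.1 ((TensorProduct.eq_zero_or_eq_zero_of_tmul_eq_zero e).resolve_right hb0)).symm

end YetterDrinfeld

/-! ### Products of homogeneous elements and coproducts with a primitive factor -/

namespace BialgebraData

variable {R G M : Type*} [CommRing R] [Group G] [Fintype G] [AddCommGroup M] [Module R M]
  {S : BialgebraData R M} {Y : YetterDrinfeld R G M}

theorem IsYetterDrinfeld.act_mul (hS : S.IsYetterDrinfeld Y) (g : G) (a b : M) :
    Y.act g (S.mul (a ⊗ₜ b)) = S.mul (Y.act g a ⊗ₜ Y.act g b) :=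
  (LinearMap.congr_fun (hS.mul.act g) (a ⊗ₜ b)).symm

theorem IsYetterDrinfeld.proj_mul (hS : S.IsYetterDrinfeld Y) {g h : G} {a b : M}
    (ha : Y.proj g a = a) (hb : Y.proj h b = b) :
    Y.proj (g * h) (S.mul (a ⊗ₜ b)) = S.mul (a ⊗ₜ b) := by
  have := LinearMap.congr_fun (hS.mul.proj (g * h)) (a ⊗ₜ b)
  rw [LinearMap.comp_apply, LinearMap.comp_apply,
    YetterDrinfeld.tensor_proj_tmul_of_proj _ _ ha hb] at this
  exact this.symm

/-- The comultiplication of the product with a primitive element of degree `g`. -/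
theorem IsBialgebra.comul_mul_of_primitive (hS : S.IsBialgebra (Y.braiding Y)) {g : G} {e a : M}
    (he : S.unit 1 = e) (he' : Y.proj 1 e = e) (ha : Y.proj g a = a)
    (hc : S.comul a = a ⊗ₜ e + e ⊗ₜ a) (u : M) :
    S.comul (S.mul (a ⊗ₜ u)) =
      TensorProduct.map (S.mul ∘ₗ TensorProduct.mk R M M a) LinearMap.id (S.comul u) +
        TensorProduct.map (Y.act g) (S.mul ∘ₗ TensorProduct.mk R M M a) (S.comul u) := by
  have h := LinearMap.congr_fun hS.comul_mul (a ⊗ₜ u)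
  have hu : ∀ v, S.mul (e ⊗ₜ v) = v := fun v => by
    simpa [he] using LinearMap.congr_fun hS.unit_mul (1 ⊗ₜ v)
  simp only [LinearMap.comp_apply, TensorProduct.map_tmul, hc] at h
  rw [h]
  -- Both sides are linear in the coproduct of `u`, so it may be replaced by an arbitrary tensor and
  -- then by a pure one.
  generalize S.comul u = z
  induction z with
  | zero => simp
  | add x y hx hy => simp only [TensorProduct.tmul_add, map_add, hx, hy]; abel
  | tmul x y =>
    simp [midBraiding, TensorProduct.add_tmul, YetterDrinfeld.braiding_tmul_of_proj _ _ he',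
      YetterDrinfeld.braiding_tmul_of_proj _ _ ha, hu]

end BialgebraData

/-! ### Degrees 0 and 1 of `FK_n`, and the grading of `FK_n[t]` -/

namespace FominKirillov

variable {k : Type*} [CommRing k] {n : ℕ}

theorem proj_x (g : Equiv.Perm (Fin n)) (i j : Fin n) :
    proj g (x k i j) = if g = Equiv.swap i j then x k i j else 0 := by
  have := proj_mono (k := k) g [(i, j)]
  rwa [mono_cons, mono_nil, mul_one, deg_cons, deg_nil, mul_one] at this

theorem exists_smul_one_of_mem_gr_zero {b : FominKirillov k n} (hb : b ∈ gr k n 0) :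
    ∃ r : k, b = r • 1 := by
  have : gr k n 0 ≤ Submodule.span k {1} := Submodule.span_mono (by
    rintro _ ⟨w, hw, rfl⟩
    rw [List.length_eq_zero_iff.1 hw]; rfl)
  obtain ⟨r, hr⟩ := Submodule.mem_span_singleton.1 (this hb)
  exact ⟨r, hr.symm⟩

theorem gr_one_le : gr k n 1 ≤ Submodule.span k (Set.range fun p : Fin n × Fin n => x k p.1 p.2) :=
  Submodule.span_mono (by
    rintro _ ⟨w, hw, rfl⟩
    obtain ⟨p, rfl⟩ := List.length_eq_one_iff.1 hw
    exact ⟨p, by simp [mono_cons, mono_nil]⟩)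

theorem x_mem_gr (i j : Fin n) : x k i j ∈ gr k n 1 := by
  simpa [mono_cons, mono_nil] using mono_mem_gr (k := k) [(i, j)]

theorem one_mem_gr : (1 : FominKirillov k n) ∈ gr k n 0 := mono_mem_gr []

/-- Generators lie over transpositions, which are odd. This parity excludes a term linear in `t`
from a deformed quadratic relation. -/
theorem proj_eq_zero_of_mem_gr_one {g : Equiv.Perm (Fin n)} (hg : Equiv.Perm.sign g = 1)
    {b : FominKirillov k n} (hb : b ∈ gr k n 1) : proj g b = 0 := by
  replace hb := gr_one_le hb
  induction hb using Submodule.span_induction with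
  | mem b h =>
    obtain ⟨⟨i, j⟩, rfl⟩ := h
    change proj g (x k i j) = 0
    by_cases hij : i = j
    · rw [hij, x_self, map_zero]
    · rw [proj_x, if_neg]
      rintro rfl
      rw [Equiv.Perm.sign_swap hij] at hg
      exact absurd hg (by decide)
  | zero => simp
  | add a b _ _ ha hb => rw [map_add, ha, hb, add_zero]
  | smul r a _ ha => rw [map_smul, ha, smul_zero]

/-! ### The module `FK_n[t]` -/

/-- `FK_n[t]`. -/
abbrev PolyFK (k : Type*) [CommRing k] (n : ℕ) := Polynomial k ⊗[k] FominKirillov k n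

/-- The element `x_(ij)` of `FK_n[t]`. -/
noncomputable abbrev xT (k : Type*) [CommRing k] {n : ℕ} (i j : Fin n) : PolyFK k n :=
  1 ⊗ₜ x k i j

theorem xT_self (i : Fin n) : xT k i i = 0 := by rw [xT, x_self, TensorProduct.tmul_zero]

theorem xT_anti (i j : Fin n) : xT k j i = -xT k i j := by
  rw [xT, x_anti i j, TensorProduct.tmul_neg]

theorem ydT_act_tmul (g : Equiv.Perm (Fin n)) (p : Polynomial k) (b : FominKirillov k n) :
    (gradedBialgebra k n).ydT.act g (p ⊗ₜ b) = p ⊗ₜ act g b := rfl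

theorem ydT_proj_tmul (g : Equiv.Perm (Fin n)) (p : Polynomial k) (b : FominKirillov k n) :
    (gradedBialgebra k n).ydT.proj g (p ⊗ₜ b) = p ⊗ₜ proj g b := rfl

theorem ydT_proj_xT (i j : Fin n) :
    (gradedBialgebra k n).ydT.proj (Equiv.swap i j) (xT k i j) = xT k i j := by
  rw [ydT_proj_tmul, proj_x, if_pos rfl]

theorem specializeZero_tmul (p : Polynomial k) (b : FominKirillov k n) :
    specializeZero k (FominKirillov k n) (p ⊗ₜ b) = p.coeff 0 • b := by
  simp [specializeZero]

theorem coeff_tmul (s : ℕ) (p : Polynomial k) (b : FominKirillov k n) :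
    TensorProduct.lid k (FominKirillov k n) (LinearMap.rTensor _ (Polynomial.lcoeff k s) (p ⊗ₜ b)) =
      p.coeff s • b := by
  simp

theorem specializeZero_smul (p : Polynomial k) (z : PolyFK k n) :
    specializeZero k (FominKirillov k n) (p • z) = p.coeff 0 • specializeZero k _ z := by
  induction z using TensorProduct.induction_on with
  | zero => simp
  | add a b ha hb => simp only [smul_add, map_add, ha, hb]
  | tmul q b => simp [TensorProduct.smul_tmul', specializeZero_tmul, mul_smul]

theorem monomial_tmul_mem_grT {i j d : ℕ} (h : i + j = d) (r : k) {b : FominKirillov k n}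
    (hb : b ∈ gr k n j) : Polynomial.monomial i r ⊗ₜ[k] b ∈ (gradedBialgebra k n).grT d :=
  AddSubgroup.subset_closure ⟨i, j, h, _, ⟨r, rfl⟩, b, hb, rfl⟩

theorem X_pow_tmul_mem_grT {i j d : ℕ} (h : i + j = d) {b : FominKirillov k n}
    (hb : b ∈ gr k n j) :
    (Polynomial.X ^ i : Polynomial k) ⊗ₜ[k] b ∈ (gradedBialgebra k n).grT d := by
  rw [Polynomial.X_pow_eq_monomial]
  exact monomial_tmul_mem_grT h 1 hb

theorem one_tmul_mem_grT {d : ℕ} {b : FominKirillov k n} (hb : b ∈ gr k n d) :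
    (1 : Polynomial k) ⊗ₜ[k] b ∈ (gradedBialgebra k n).grT d := by
  simpa using X_pow_tmul_mem_grT (i := 0) (zero_add d) hb

/-- The normal form behind all degree counts: scalars are absorbed into the `FK_n` factor, so only
powers of `t` remain on the left. -/
theorem exists_sum_of_mem_grT {d : ℕ} {z : PolyFK k n} (hz : z ∈ (gradedBialgebra k n).grT d) :
    ∃ c : ℕ → FominKirillov k n, (∀ s ≤ d, c s ∈ gr k n (d - s)) ∧
      z = ∑ s ∈ Finset.range (d + 1), (Polynomial.X ^ s : Polynomial k) ⊗ₜ[k] c s := by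
  induction hz using AddSubgroup.closure_induction with
  | mem z h =>
    obtain ⟨i, j, rfl, _, ⟨r, rfl⟩, b, hb, rfl⟩ := h
    refine ⟨Pi.single i (r • b), fun s hs => ?_, ?_⟩
    · by_cases h : s = i
      · subst h
        rw [Pi.single_eq_same, Nat.add_sub_cancel_left]
        exact Submodule.smul_mem _ _ hb
      · rw [Pi.single_eq_of_ne h]; exact zero_mem _
    · rw [Finset.sum_eq_single i]
      · rw [Pi.single_eq_same, ← TensorProduct.smul_tmul, Polynomial.smul_X_eq_monomial]
      · intro s _ hs; rw [Pi.single_eq_of_ne hs, TensorProduct.tmul_zero]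
      · simp
  | zero => exact ⟨0, fun _ _ => zero_mem _, by simp⟩
  | add a b _ _ ha hb =>
    obtain ⟨u, hu, rfl⟩ := ha
    obtain ⟨v, hv, rfl⟩ := hb
    exact ⟨u + v, fun s hs => add_mem (hu s hs) (hv s hs), by
      simp [TensorProduct.tmul_add, Finset.sum_add_distrib]⟩
  | neg a _ ha =>
    obtain ⟨u, hu, rfl⟩ := ha
    exact ⟨-u, fun s hs => neg_mem (hu s hs), by simp [TensorProduct.tmul_neg]⟩

theorem smul_mem_grT {p : Polynomial k} {i j d : ℕ} (h : i + j = d)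
    (hp : p ∈ polynomialGrading k i) {z : PolyFK k n}
    (hz : z ∈ (gradedBialgebra k n).grT j) : p • z ∈ (gradedBialgebra k n).grT d := by
  subst h
  obtain ⟨r, rfl⟩ := hp
  induction hz using AddSubgroup.closure_induction with
  | mem z h =>
    obtain ⟨l, m, rfl, _, ⟨s, rfl⟩, b, hb, rfl⟩ := h
    rw [TensorProduct.smul_tmul', smul_eq_mul, Polynomial.monomial_mul_monomial]
    exact monomial_tmul_mem_grT (add_assoc _ _ _) _ hb
  | zero => simp
  | add a b _ _ ha hb => rw [smul_add]; exact add_mem ha hb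
  | neg a _ ha => rw [smul_neg]; exact neg_mem ha

end FominKirillov

/-! ### Relations and primitive generators in a deformation -/

namespace FominKirillov

variable {k : Type*} [CommRing k] {n : ℕ}
  {S : BialgebraData (Polynomial k) (PolyFK k n)}

theorem deformation_mul_assoc (hS : (gradedBialgebra k n).IsDeformation S) (u v w : PolyFK k n) :
    S.mul (S.mul (u ⊗ₜ v) ⊗ₜ w) = S.mul (u ⊗ₜ S.mul (v ⊗ₜ w)) :=
  congrArg (fun f => f ((u ⊗ₜ v) ⊗ₜ w)) hS.isBialgebra.mul_assoc

/-- The degree 0 part of `FK_n[t]` consists of scalars, so the deformed unit is a scalar multiple of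
the old one. The unit law at `t = 0` shows that the scalar is 1. -/
theorem deformation_unit (hS : (gradedBialgebra k n).IsDeformation S) :
    S.unit 1 = 1 ⊗ₜ 1 := by
  have h1 : (1 : Polynomial k) ∈ polynomialGrading k 0 := ⟨1, rfl⟩
  obtain ⟨c, hc, h⟩ := exists_sum_of_mem_grT (hS.isGraded.unit 0 1 h1)
  obtain ⟨r, hr⟩ := exists_smul_one_of_mem_gr_zero (hc 0 le_rfl)
  have h : S.unit 1 = 1 ⊗ₜ (r • 1) := by simpa [hr] using h
  have e := congrArg (fun f => specializeZero k _ (f (1 ⊗ₜ (1 ⊗ₜ 1)))) hS.isBialgebra.unit_mul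
  simp only [LinearMap.comp_apply, LinearMap.rTensor_tmul, h, hS.mul_zero, LinearEquiv.coe_coe,
    TensorProduct.lid_tmul, one_smul, specializeZero_tmul, Polynomial.coeff_one_zero] at e
  change r • 1 * (1 : FominKirillov k n) = 1 at e
  rw [mul_one] at e
  rw [h, e]

theorem deformation_counit_one (hS : (gradedBialgebra k n).IsDeformation S) :
    S.counit (1 ⊗ₜ 1) = 1 := by
  rw [← deformation_unit hS]
  exact congrArg (fun f => f 1) hS.isBialgebra.counit_unit

theorem deformation_one_mul (hS : (gradedBialgebra k n).IsDeformation S) (u : PolyFK k n) :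
    S.mul ((1 ⊗ₜ 1) ⊗ₜ u) = u := by
  have := congrArg (fun f => f (1 ⊗ₜ u)) hS.isBialgebra.unit_mul
  simpa [deformation_unit hS] using this

theorem deformation_counit_mul (hS : (gradedBialgebra k n).IsDeformation S) (u v : PolyFK k n) :
    S.counit (S.mul (u ⊗ₜ v)) = S.counit u * S.counit v :=
  congrArg (fun f => f (u ⊗ₜ v)) hS.isBialgebra.counit_mul

theorem deformation_mul_mem (hS : (gradedBialgebra k n).IsDeformation S) {i j : ℕ}
    {u v : PolyFK k n} (hu : u ∈ (gradedBialgebra k n).grT i)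
    (hv : v ∈ (gradedBialgebra k n).grT j) :
    S.mul (u ⊗ₜ v) ∈ (gradedBialgebra k n).grT (i + j) :=
  hS.isGraded.mul _ _ (AddSubgroup.subset_closure ⟨i, j, rfl, u, hu, v, hv, rfl⟩)

/-- The specialization axiom concerns only the elements `1 ⊗ b`; `k[t]`-linearity of the product
extends it to any second factor. -/
theorem specializeZero_deformation_mul (hS : (gradedBialgebra k n).IsDeformation S)
    (a : FominKirillov k n) (u : PolyFK k n) :
    specializeZero k _ (S.mul ((1 ⊗ₜ a) ⊗ₜ u)) = a * specializeZero k _ u := by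
  induction u using TensorProduct.induction_on with
  | zero => simp
  | add u v hu hv => simp only [TensorProduct.tmul_add, map_add, hu, hv, mul_add]
  | tmul p b =>
    have : p ⊗ₜ[k] b = p • ((1 : Polynomial k) ⊗ₜ[k] b) := by
      rw [TensorProduct.smul_tmul', smul_eq_mul, mul_one]
    rw [this, TensorProduct.tmul_smul, map_smul, specializeZero_smul, specializeZero_smul,
      hS.mul_zero, specializeZero_tmul]
    change _ • (a * b) = _
    simp

/-- The counit preserves the coaction, and the unit object is concentrated in degree 1. -/
theorem counit_eq_zero_of_proj (hS : (gradedBialgebra k n).IsYDDeformation S)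
    {g : Equiv.Perm (Fin n)} (hg : g ≠ 1) {u : PolyFK k n}
    (hu : (gradedBialgebra k n).ydT.proj g u = u) : S.counit u = 0 := by
  have := congrArg (fun f => f u) (hS.isYetterDrinfeld.counit.proj g)
  simpa [YetterDrinfeld.unit_proj_ne hg, hu] using this

theorem counit_xT (hS : (gradedBialgebra k n).IsYDDeformation S) (i j : Fin n) :
    S.counit (xT k i j) = 0 := by
  by_cases hij : i = j
  · rw [hij, xT_self, map_zero]
  · exact counit_eq_zero_of_proj hS (by simpa using hij) (ydT_proj_xT i j)

theorem counit_one_tmul_of_mem_gr_one (hS : (gradedBialgebra k n).IsYDDeformation S)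
    {b : FominKirillov k n} (hb : b ∈ gr k n 1) : S.counit (1 ⊗ₜ b) = 0 := by
  replace hb := gr_one_le hb
  induction hb using Submodule.span_induction with
  | mem b h => obtain ⟨p, rfl⟩ := h; exact counit_xT hS p.1 p.2
  | zero => simp
  | add a b _ _ ha hb => rw [TensorProduct.tmul_add, map_add, ha, hb, add_zero]
  | smul r a _ ha =>
    rw [← TensorProduct.smul_tmul, ← mul_one (r • (1 : Polynomial k)), ← smul_eq_mul,
      ← TensorProduct.smul_tmul', map_smul, ha, smul_zero]

/-- An element of `FK_n[t]` of degree `2` that vanishes at `t = 0`, has even coaction degree and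
vanishes under the counit, is zero. -/
theorem eq_zero_of_mem_grT_two (hS : (gradedBialgebra k n).IsYDDeformation S)
    {g : Equiv.Perm (Fin n)} (hg : Equiv.Perm.sign g = 1) {w : PolyFK k n}
    (hw : w ∈ (gradedBialgebra k n).grT 2) (h0 : specializeZero k _ w = 0)
    (hp : (gradedBialgebra k n).ydT.proj g w = w) (hc : S.counit w = 0) : w = 0 := by
  -- Write `w = c₀ + t c₁ + t² c₂` with `c₂` a scalar `r`; the value at `t = 0` gives `c₀ = 0`.
  obtain ⟨c, hc', rfl⟩ := exists_sum_of_mem_grT hw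
  obtain ⟨r, hr⟩ := exists_smul_one_of_mem_gr_zero (hc' 2 le_rfl)
  have h₁ := proj_eq_zero_of_mem_gr_one hg (hc' 1 (by norm_num))
  simp only [Finset.sum_range_succ, Finset.range_zero, Finset.sum_empty, zero_add, map_add,
    specializeZero_tmul, pow_zero, pow_one, Polynomial.coeff_one_zero, Polynomial.coeff_X_zero,
    one_smul, zero_smul, add_zero, Polynomial.coeff_X_pow, (by norm_num : ¬ 0 = 2), if_false]
    at h0
  simp only [Finset.sum_range_succ, Finset.range_zero, Finset.sum_empty, zero_add, map_add,
    ydT_proj_tmul, pow_one, h0, h₁, TensorProduct.tmul_zero] at hp hc ⊢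
  -- The coefficient of `t` in `proj g w = w` reads `0 = c₁`, by parity.
  have hp := congrArg (fun z => TensorProduct.lid k (FominKirillov k n)
    (LinearMap.rTensor _ (Polynomial.lcoeff k 1) z)) hp
  simp only [map_add, coeff_tmul, Polynomial.coeff_X_one, Polynomial.coeff_X_pow, one_smul,
    (by norm_num : ¬ 1 = 2), if_false, zero_smul, add_zero] at hp
  have e : (Polynomial.X ^ 2 : Polynomial k) ⊗ₜ[k] (r • 1 : FominKirillov k n) =
      Polynomial.monomial 2 r • (1 ⊗ₜ 1) := by
    rw [← TensorProduct.smul_tmul, Polynomial.smul_X_eq_monomial, TensorProduct.smul_tmul',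
      smul_eq_mul, mul_one]
  -- Only `r t²` is left, and its counit is `r t²` itself, so `r = 0`.
  rw [hr, e, ← hp, TensorProduct.tmul_zero, map_zero, map_smul,
    deformation_counit_one hS.toIsDeformation, zero_add, smul_eq_mul, mul_one,
    Polynomial.monomial_eq_zero_iff] at hc
  rw [hr, ← hp, hc]
  simp

/-- The product of two generators in the deformation is homogeneous of degree `2`, with the expected
value at `t = 0` and the expected coaction degree, and vanishes under the counit. -/
theorem deformation_mul_xT_xT (hS : (gradedBialgebra k n).IsYDDeformation S) (i j l m : Fin n) :
    S.mul (xT k i j ⊗ₜ xT k l m) ∈ (gradedBialgebra k n).grT 2 ∧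
    specializeZero k _ (S.mul (xT k i j ⊗ₜ xT k l m)) = x k i j * x k l m ∧
    (gradedBialgebra k n).ydT.proj (Equiv.swap i j * Equiv.swap l m)
      (S.mul (xT k i j ⊗ₜ xT k l m)) = S.mul (xT k i j ⊗ₜ xT k l m) ∧
    S.counit (S.mul (xT k i j ⊗ₜ xT k l m)) = 0 := by
  refine ⟨?_, hS.mul_zero _ _, ?_, ?_⟩
  · have h := deformation_mul_mem hS.toIsDeformation (i := 1) (j := 1)
      (one_tmul_mem_grT (x_mem_gr i j)) (one_tmul_mem_grT (x_mem_gr l m))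
    exact h
  · have h := hS.isYetterDrinfeld
    have h' := h.proj_mul (g := Equiv.swap i j) (a := xT k i j) (ydT_proj_xT i j)
      (ydT_proj_xT l m)
    exact h'
  · rw [deformation_counit_mul hS.toIsDeformation, counit_xT hS, zero_mul]

/-- Left multiplication by `x_(ij)` in the deformation. -/
noncomputable def deformationLeftMul (S : BialgebraData (Polynomial k) (PolyFK k n))
    (i j : Fin n) : Module.End k (PolyFK k n) :=
  (S.mul ∘ₗ TensorProduct.mk (Polynomial k) (PolyFK k n) (PolyFK k n) (xT k i j)).restrictScalars k

theorem deformationLeftMul_apply (i j : Fin n) (u : PolyFK k n) :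
    deformationLeftMul S i j u = S.mul (xT k i j ⊗ₜ u) := rfl

/-- By associativity, a quadratic relation between left multiplications follows from the same
relation between deformed products of two generators. -/
theorem deformationLeftMul_mul (hS : (gradedBialgebra k n).IsDeformation S) (i j l m : Fin n)
    (u : PolyFK k n) : (deformationLeftMul S i j * deformationLeftMul S l m) u =
      S.mul (S.mul (xT k i j ⊗ₜ xT k l m) ⊗ₜ u) := by
  rw [Module.End.mul_apply, deformationLeftMul_apply, deformationLeftMul_apply,
    deformation_mul_assoc hS]

/-- The defect of each relation satisfies all the conditions of `eq_zero_of_mem_grT_two`: its terms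
lie over one common even permutation, and the relation holds at `t = 0`. Working with operators
supplies the associative algebra that `lift` needs, since the deformed product is only a bilinear
map. -/
theorem isFK_deformationLeftMul (hS : (gradedBialgebra k n).IsYDDeformation S) :
    IsFK (deformationLeftMul S) where
  self i := LinearMap.ext fun u => by
    rw [deformationLeftMul_apply, xT_self, TensorProduct.zero_tmul, map_zero, LinearMap.zero_apply]
  anti i j := LinearMap.ext fun u => by
    rw [LinearMap.neg_apply, deformationLeftMul_apply, deformationLeftMul_apply, xT_anti i j,
      TensorProduct.neg_tmul]
    exact map_neg S.mul _
  sq i j hij := LinearMap.ext fun u => by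
    obtain ⟨h₁, h₂, h₃, h₄⟩ := deformation_mul_xT_xT hS i j i j
    rw [deformationLeftMul_mul hS.toIsDeformation, eq_zero_of_mem_grT_two hS
      (g := Equiv.swap i j * Equiv.swap i j) (by simp) h₁ (by rw [h₂, x_sq]) h₃ h₄]
    simp
  cyc i j l a b c := LinearMap.ext fun u => by
    obtain ⟨h₁, h₂, h₃, h₄⟩ := deformation_mul_xT_xT hS i j j l
    obtain ⟨h₁', h₂', h₃', h₄'⟩ := deformation_mul_xT_xT hS j l l i
    obtain ⟨h₁'', h₂'', h₃'', h₄''⟩ := deformation_mul_xT_xT hS l i i j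
    -- The three terms of the cyclic relation lie over the same 3-cycle; their degrees are rewritten
    -- as `(ij)(jl)` so that the sum is visibly homogeneous.
    rw [← swap_cyc j l i b a.symm, ← swap_cyc i j l a c] at h₃''
    rw [← swap_cyc i j l a c] at h₃'
    have := eq_zero_of_mem_grT_two hS (g := Equiv.swap i j * Equiv.swap j l)
      (by rw [Equiv.Perm.sign_mul, Equiv.Perm.sign_swap a, Equiv.Perm.sign_swap b]; rfl)
      (add_mem (add_mem h₁ h₁') h₁'') (by rw [map_add, map_add, h₂, h₂', h₂'', x_cyc i j l a b c])
      (by rw [map_add, map_add, h₃, h₃', h₃''])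
      (by rw [map_add, map_add, h₄, h₄', h₄'', add_zero, add_zero])
    rw [LinearMap.add_apply, LinearMap.add_apply, deformationLeftMul_mul hS.toIsDeformation,
      deformationLeftMul_mul hS.toIsDeformation, deformationLeftMul_mul hS.toIsDeformation,
      ← map_add, ← map_add, ← TensorProduct.add_tmul, ← TensorProduct.add_tmul, this]
    simp
  comm i j l m h h' a b c d := LinearMap.ext fun u => by
    obtain ⟨h₁, h₂, h₃, h₄⟩ := deformation_mul_xT_xT hS i j l m
    obtain ⟨h₁', h₂', h₃', h₄'⟩ := deformation_mul_xT_xT hS l m i j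
    have e : Equiv.swap l m * Equiv.swap i j = Equiv.swap i j * Equiv.swap l m := by
      rw [Equiv.mul_swap_eq_swap_mul (Equiv.swap i j), Equiv.swap_apply_of_ne_of_ne a.symm c.symm,
        Equiv.swap_apply_of_ne_of_ne b.symm d.symm]
    rw [e] at h₃'
    have := eq_zero_of_mem_grT_two hS (g := Equiv.swap i j * Equiv.swap l m)
      (by rw [Equiv.Perm.sign_mul, Equiv.Perm.sign_swap h, Equiv.Perm.sign_swap h']; rfl)
      (sub_mem h₁ h₁') (by rw [map_sub, h₂, h₂', x_comm i j l m a b c d, sub_self])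
      (by rw [map_sub, h₃, h₃']) (by rw [map_sub, h₄, h₄', sub_zero])
    rw [deformationLeftMul_mul hS.toIsDeformation, deformationLeftMul_mul hS.toIsDeformation,
      sub_eq_zero.1 this]

theorem neg_tmul_add_tmul_add_smul {R M : Type*} [CommRing R] [AddCommGroup M] [Module R M]
    (a b c d : M) (p : R) (e : M ⊗[R] M) :
    -(a ⊗ₜ[R] b + c ⊗ₜ[R] d + p • e) = (-a) ⊗ₜ[R] b + c ⊗ₜ[R] (-d) + (-p) • e := by
  rw [TensorProduct.neg_tmul, TensorProduct.tmul_neg, neg_smul]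
  abel

theorem monomial_tmul_eq_smul (i : ℕ) (r : k) (b : FominKirillov k n) :
    Polynomial.monomial i r ⊗ₜ[k] b = Polynomial.monomial i r • ((1 : Polynomial k) ⊗ₜ[k] b) := by
  rw [TensorProduct.smul_tmul', smul_eq_mul, mul_one]

theorem one_tmul_smul_eq_smul (r : k) (b : FominKirillov k n) :
    (1 : Polynomial k) ⊗ₜ[k] (r • b) = Polynomial.C r • ((1 : Polynomial k) ⊗ₜ[k] b) := by
  rw [TensorProduct.smul_tmul', smul_eq_mul, mul_one, ← TensorProduct.smul_tmul,
    Polynomial.smul_eq_C_mul, mul_one]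

/-- The generators are primitive in the deformation. -/
theorem deformation_comul_xT (hS : (gradedBialgebra k n).IsYDDeformation S) (i j : Fin n) :
    S.comul (xT k i j) = xT k i j ⊗ₜ (1 ⊗ₜ 1) + (1 ⊗ₜ 1) ⊗ₜ xT k i j := by
  -- The degree 1 part of the tensor square leaves only `b ⊗ 1`, `1 ⊗ b'` and a scalar multiple of
  -- `t (1 ⊗ 1)`.
  have shape : ∀ z ∈ tensorGrading (Polynomial k) (gradedBialgebra k n).grT
      (gradedBialgebra k n).grT 1, ∃ b ∈ gr k n 1, ∃ b' ∈ gr k n 1, ∃ r : k,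
      z = (1 ⊗ₜ b) ⊗ₜ (1 ⊗ₜ 1) + (1 ⊗ₜ 1) ⊗ₜ (1 ⊗ₜ b') +
        (Polynomial.monomial 1 r) • ((1 ⊗ₜ 1) ⊗ₜ (1 ⊗ₜ 1)) := by
    have shape₀ : ∀ u ∈ (gradedBialgebra k n).grT 0, ∃ r : k, u = 1 ⊗ₜ (r • 1) := by
      intro u hu
      obtain ⟨c, hc, rfl⟩ := exists_sum_of_mem_grT hu
      obtain ⟨r, hr⟩ := exists_smul_one_of_mem_gr_zero (hc 0 le_rfl)
      exact ⟨r, by simp [hr]⟩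
    have shape₁ : ∀ u ∈ (gradedBialgebra k n).grT 1, ∃ b ∈ gr k n 1, ∃ r : k,
        u = 1 ⊗ₜ b + Polynomial.monomial 1 r ⊗ₜ 1 := by
      intro u hu
      obtain ⟨c, hc, rfl⟩ := exists_sum_of_mem_grT hu
      obtain ⟨r, hr⟩ := exists_smul_one_of_mem_gr_zero (hc 1 le_rfl)
      refine ⟨c 0, hc 0 zero_le_one, r, ?_⟩
      simp [Finset.sum_range_succ, hr, ← Polynomial.smul_X_eq_monomial, TensorProduct.smul_tmul]
    intro z hz
    induction hz using AddSubgroup.closure_induction with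
    | mem z h =>
      obtain ⟨p, q, hpq, u, hu, v, hv, rfl⟩ := h
      obtain ⟨rfl, rfl⟩ | ⟨rfl, rfl⟩ : p = 0 ∧ q = 1 ∨ p = 1 ∧ q = 0 := by omega
      · obtain ⟨r, rfl⟩ := shape₀ u hu
        obtain ⟨b, hb, s, rfl⟩ := shape₁ v hv
        refine ⟨0, zero_mem _, r • b, Submodule.smul_mem _ _ hb, r * s, ?_⟩
        simp only [monomial_tmul_eq_smul 1 s, one_tmul_smul_eq_smul]
        rw [TensorProduct.tmul_zero, TensorProduct.zero_tmul, zero_add, TensorProduct.tmul_add,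
          TensorProduct.tmul_smul, ← TensorProduct.smul_tmul', ← TensorProduct.smul_tmul',
          TensorProduct.tmul_smul, smul_smul, Polynomial.monomial_mul_C, mul_comm r s]
      · obtain ⟨r, rfl⟩ := shape₀ v hv
        obtain ⟨b, hb, s, rfl⟩ := shape₁ u hu
        refine ⟨r • b, Submodule.smul_mem _ _ hb, 0, zero_mem _, r * s, ?_⟩
        simp only [monomial_tmul_eq_smul 1 s, one_tmul_smul_eq_smul]
        rw [TensorProduct.tmul_zero, TensorProduct.tmul_zero, add_zero, TensorProduct.add_tmul,
          TensorProduct.tmul_smul, ← TensorProduct.smul_tmul', ← TensorProduct.smul_tmul',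
          TensorProduct.tmul_smul, smul_smul, Polynomial.monomial_mul_C, mul_comm r s]
    | zero => exact ⟨0, zero_mem _, 0, zero_mem _, 0, by simp⟩
    | add a b _ _ ha hb =>
      obtain ⟨u, hu, v, hv, r, rfl⟩ := ha
      obtain ⟨u', hu', v', hv', r', rfl⟩ := hb
      refine ⟨u + u', add_mem hu hu', v + v', add_mem hv hv', r + r', ?_⟩
      simp only [TensorProduct.tmul_add, TensorProduct.add_tmul, map_add, add_smul]
      abel
    | neg a _ ha =>
      obtain ⟨u, hu, v, hv, r, rfl⟩ := ha
      refine ⟨-u, neg_mem hu, -v, neg_mem hv, -r, ?_⟩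
      rw [map_neg, TensorProduct.tmul_neg, TensorProduct.tmul_neg]
      exact neg_tmul_add_tmul_add_smul _ _ _ _ _ _
  obtain ⟨b, hb, b', hb', r, h⟩ :=
    shape _ (hS.isGraded.comul 1 _ (one_tmul_mem_grT (x_mem_gr i j)))
  -- The counit kills degree 1 of `FK_n`, so the left and right counit laws give `b' + r t = x_(ij)`
  -- and `b + r t = x_(ij)` respectively.
  have e₁ := LinearMap.congr_fun hS.isBialgebra.counit_comul (xT k i j)
  have e₂ := LinearMap.congr_fun hS.isBialgebra.comul_counit (xT k i j)
  rw [LinearMap.comp_apply] at e₁ e₂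
  simp only [h, map_add, map_smul, LinearMap.rTensor_tmul, LinearMap.lTensor_tmul,
    counit_one_tmul_of_mem_gr_one hS hb, counit_one_tmul_of_mem_gr_one hS hb',
    deformation_counit_one hS.toIsDeformation, LinearEquiv.coe_coe, TensorProduct.lid_symm_apply,
    TensorProduct.rid_symm_apply, TensorProduct.zero_tmul, TensorProduct.tmul_zero] at e₁ e₂
  have e₁ := congrArg (TensorProduct.lid (Polynomial k) (PolyFK k n)) e₁
  have e₂ := congrArg (TensorProduct.rid (Polynomial k) (PolyFK k n)) e₂
  simp only [map_add, map_smul, TensorProduct.lid_tmul, TensorProduct.rid_tmul, one_smul,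
    zero_add, add_zero] at e₁ e₂
  -- Setting `t = 0` discards `r t` and identifies both `b'` and `b` with `x_(ij)`.
  have hx : ∀ c : FominKirillov k n, (1 : Polynomial k) ⊗ₜ[k] c +
      Polynomial.monomial 1 r • ((1 : Polynomial k) ⊗ₜ[k] (1 : FominKirillov k n)) = xT k i j →
      c = x k i j := fun c hc => by
    have := congrArg (specializeZero k _) hc
    rw [map_add, specializeZero_smul, specializeZero_tmul, specializeZero_tmul, specializeZero_tmul,
      Polynomial.coeff_monomial, if_neg one_ne_zero, zero_smul, add_zero,
      Polynomial.coeff_one_zero, one_smul, one_smul] at this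
    exact this
  obtain rfl := hx _ e₁
  obtain rfl := hx _ e₂
  -- What remains is `r t · 1 = 0`; applying the counit turns it into an identity of polynomials.
  have hr := congrArg S.counit (add_eq_left.1 e₁)
  rw [map_smul, deformation_counit_one hS.toIsDeformation, smul_eq_mul, mul_one, map_zero] at hr
  rw [h, hr, zero_smul, add_zero]

end FominKirillov

/-! ### The isomorphism from the trivial deformation -/

namespace FominKirillov

variable {k : Type*} [CommRing k] {n : ℕ}
  {S : BialgebraData (Polynomial k) (PolyFK k n)}

/-- The map `FK_n → FK_n[t]` that is multiplicative for the deformed product and sends each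
generator to itself. -/
noncomputable def deformationLift (hS : (gradedBialgebra k n).IsYDDeformation S) :
    FominKirillov k n →ₗ[k] PolyFK k n :=
  LinearMap.applyₗ (1 ⊗ₜ[k] 1) ∘ₗ (lift (k := k) _ (isFK_deformationLeftMul hS)).toLinearMap

theorem deformationLift_one (hS : (gradedBialgebra k n).IsYDDeformation S) :
    deformationLift hS 1 = 1 ⊗ₜ 1 := by
  simp [deformationLift]

theorem deformationLift_x_mul (hS : (gradedBialgebra k n).IsYDDeformation S) (i j : Fin n)
    (b : FominKirillov k n) :
    deformationLift hS (x k i j * b) = S.mul (xT k i j ⊗ₜ deformationLift hS b) := by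
  simp [deformationLift, lift_x, deformationLeftMul_apply]

/-- The lift takes values in operators and is then evaluated at the unit, so multiplicativity has to
be recovered: induction on the word in the first factor, with associativity of the deformed product
at each letter. -/
theorem deformationLift_mul (hS : (gradedBialgebra k n).IsYDDeformation S)
    (a b : FominKirillov k n) :
    deformationLift hS (a * b) = S.mul (deformationLift hS a ⊗ₜ deformationLift hS b) := by
  have : deformationLift hS ∘ₗ (LinearMap.mul k _).flip b =
      ((S.mul ∘ₗ (TensorProduct.mk (Polynomial k) (PolyFK k n) (PolyFK k n)).flip
        (deformationLift hS b)).restrictScalars k) ∘ₗ deformationLift hS := ext_mono fun w => by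
    change deformationLift hS (mono k w * b) =
      S.mul (deformationLift hS (mono k w) ⊗ₜ deformationLift hS b)
    induction w with
    | nil => rw [mono_nil, one_mul, deformationLift_one, deformation_one_mul hS.toIsDeformation]
    | cons p w ih =>
      rw [mono_cons, mul_assoc, deformationLift_x_mul, ih, deformationLift_x_mul,
        deformation_mul_assoc hS.toIsDeformation]
  exact LinearMap.congr_fun this a

theorem specializeZero_deformationLift (hS : (gradedBialgebra k n).IsYDDeformation S)
    (b : FominKirillov k n) : specializeZero k _ (deformationLift hS b) = b := by
  have : specializeZero k _ ∘ₗ deformationLift hS = LinearMap.id := ext_mono fun w => by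
    change specializeZero k _ (deformationLift hS (mono k w)) = mono k w
    induction w with
    | nil => rw [mono_nil, deformationLift_one, specializeZero_tmul]; simp
    | cons p w ih =>
      rw [mono_cons, deformationLift_x_mul, specializeZero_deformation_mul hS.toIsDeformation, ih]
  exact LinearMap.congr_fun this b

theorem deformationLift_mem (hS : (gradedBialgebra k n).IsYDDeformation S) {d : ℕ}
    {b : FominKirillov k n} (hb : b ∈ gr k n d) :
    deformationLift hS b ∈ (gradedBialgebra k n).grT d := by
  induction hb using Submodule.span_induction with
  | mem b h =>
    obtain ⟨w, rfl, rfl⟩ := h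
    induction w with
    | nil => rw [mono_nil, deformationLift_one]; exact one_tmul_mem_grT one_mem_gr
    | cons p w ih =>
      rw [mono_cons, deformationLift_x_mul, List.length_cons, add_comm]
      exact deformation_mul_mem hS.toIsDeformation (one_tmul_mem_grT (x_mem_gr _ _)) ih
  | zero => rw [map_zero]; exact zero_mem _
  | add a b _ _ ha hb => rw [map_add]; exact add_mem ha hb
  | smul r a _ ha =>
    rw [map_smul, ← algebraMap_smul (Polynomial k) r (deformationLift hS a)]
    exact smul_mem_grT (zero_add d) ⟨r, rfl⟩ ha

/-- The deformed product is equivariant, and the generators are permuted up to sign exactly as in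
`FK_n`; induction on words does the rest. -/
theorem ydT_act_deformationLift (hS : (gradedBialgebra k n).IsYDDeformation S)
    (g : Equiv.Perm (Fin n)) (b : FominKirillov k n) :
    (gradedBialgebra k n).ydT.act g (deformationLift hS b) = deformationLift hS (act g b) := by
  have : ((gradedBialgebra k n).ydT.act g).restrictScalars k ∘ₗ deformationLift hS =
      deformationLift hS ∘ₗ (act g).toLinearMap := ext_mono fun w => by
    change (gradedBialgebra k n).ydT.act g (deformationLift hS (mono k w)) =
      deformationLift hS (act g (mono k w))
    induction w with
    | nil => rw [mono_nil, deformationLift_one, ydT_act_tmul, map_one, deformationLift_one]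
    | cons p w ih =>
      have h := hS.isYetterDrinfeld
      have h' := h.act_mul g (xT k p.1 p.2) (deformationLift hS (mono k w))
      rw [mono_cons, deformationLift_x_mul, h', ih, map_mul, act_x, deformationLift_x_mul,
        ydT_act_tmul, act_x]
  exact LinearMap.congr_fun this b

theorem ydT_proj_deformationLift_mono (hS : (gradedBialgebra k n).IsYDDeformation S)
    (w : List (Fin n × Fin n)) :
    (gradedBialgebra k n).ydT.proj (deg w) (deformationLift hS (mono k w)) =
      deformationLift hS (mono k w) := by
  induction w with
  | nil =>
    rw [mono_nil, deformationLift_one, ydT_proj_tmul, ← mono_nil, proj_mono, if_pos rfl]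
  | cons p w ih =>
    have h := hS.isYetterDrinfeld
    have h' := h.proj_mul (g := Equiv.swap p.1 p.2) (a := xT k p.1 p.2) (ydT_proj_xT p.1 p.2) ih
    rw [mono_cons, deformationLift_x_mul, deg_cons]
    exact h'

theorem ydT_proj_deformationLift (hS : (gradedBialgebra k n).IsYDDeformation S)
    (g : Equiv.Perm (Fin n)) (b : FominKirillov k n) :
    (gradedBialgebra k n).ydT.proj g (deformationLift hS b) = deformationLift hS (proj g b) := by
  have : ((gradedBialgebra k n).ydT.proj g).restrictScalars k ∘ₗ deformationLift hS =
      deformationLift hS ∘ₗ proj g := ext_mono fun w => by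
    change (gradedBialgebra k n).ydT.proj g (deformationLift hS (mono k w)) =
      deformationLift hS (proj g (mono k w))
    have h := ydT_proj_deformationLift_mono hS w
    -- The image of a word is already homogeneous of the degree of the word, so any projection keeps
    -- it or kills it, as in `FK_n`.
    rw [← h, YetterDrinfeld.proj_proj, h, proj_mono]
    split_ifs
    · rfl
    · exact (map_zero _).symm
  exact LinearMap.congr_fun this b

theorem counit_deformationLift (hS : (gradedBialgebra k n).IsYDDeformation S)
    (b : FominKirillov k n) :
    S.counit (deformationLift hS b) = Polynomial.C (counit k n b) := by
  have : S.counit.restrictScalars k ∘ₗ deformationLift hS =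
      (Algebra.linearMap k (Polynomial k)) ∘ₗ (counit k n).toLinearMap := ext_mono fun w => by
    change S.counit (deformationLift hS (mono k w)) = Polynomial.C (counit k n (mono k w))
    cases w with
    | nil => rw [mono_nil, deformationLift_one, deformation_counit_one hS.toIsDeformation]; simp
    | cons p w =>
      rw [mono_cons, deformationLift_x_mul, deformation_counit_mul hS.toIsDeformation,
        counit_xT hS, map_mul, counit_x]
      simp
  exact LinearMap.congr_fun this b

theorem ydT_proj_one : (gradedBialgebra k n).ydT.proj 1 (1 ⊗ₜ 1) = 1 ⊗ₜ 1 := by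
  rw [ydT_proj_tmul, ← mono_nil, proj_mono, deg_nil, if_pos rfl]

theorem deformation_comul_xT_mul (hS : (gradedBialgebra k n).IsYDDeformation S) (i j : Fin n)
    (u : PolyFK k n) :
    S.comul (S.mul (xT k i j ⊗ₜ u)) =
      TensorProduct.map (S.mul ∘ₗ TensorProduct.mk (Polynomial k) _ _ (xT k i j)) LinearMap.id
          (S.comul u) +
        TensorProduct.map ((gradedBialgebra k n).ydT.act (Equiv.swap i j))
          (S.mul ∘ₗ TensorProduct.mk (Polynomial k) _ _ (xT k i j)) (S.comul u) := by
  have h := hS.isBialgebra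
  have h' := h.comul_mul_of_primitive (Y := (gradedBialgebra k n).ydT) (g := Equiv.swap i j)
    (e := 1 ⊗ₜ 1) (a := xT k i j) (deformation_unit hS.toIsDeformation) ydT_proj_one
    (ydT_proj_xT i j) (deformation_comul_xT hS i j) u
  exact h'

/-- The map `a ⊗ b ↦ a' ⊗ b'` from `FK_n ⊗ FK_n` to `FK_n[t] ⊗ FK_n[t]`, for
`'` the map `deformationLift`. -/
noncomputable def deformationLift₂ (hS : (gradedBialgebra k n).IsYDDeformation S) :
    FominKirillov k n ⊗[k] FominKirillov k n →ₗ[k] PolyFK k n ⊗[Polynomial k] PolyFK k n :=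
  TensorProduct.lift
    (((TensorProduct.mk (Polynomial k) (PolyFK k n) (PolyFK k n)).restrictScalars₁₂ k k).compl₁₂
      (deformationLift hS) (deformationLift hS))

theorem deformationLift₂_tmul (hS : (gradedBialgebra k n).IsYDDeformation S)
    (a b : FominKirillov k n) :
    deformationLift₂ hS (a ⊗ₜ b) = deformationLift hS a ⊗ₜ deformationLift hS b := rfl

/-- Both sides obey the same recursion on the first letter of a word. In the deformation it comes
from the primitivity of the generators; in `FK_n` it is `leftMul`, which defines the
comultiplication. -/
theorem comul_deformationLift (hS : (gradedBialgebra k n).IsYDDeformation S)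
    (b : FominKirillov k n) :
    S.comul (deformationLift hS b) = deformationLift₂ hS (comul k n b) := by
  -- The lift intertwines the two recursions because it respects left multiplication by generators
  -- and the action.
  have step : ∀ (i j : Fin n) (z : FominKirillov k n ⊗[k] FominKirillov k n),
      deformationLift₂ hS (leftMul i j z) =
        TensorProduct.map (S.mul ∘ₗ TensorProduct.mk (Polynomial k) _ _ (xT k i j)) LinearMap.id
          (deformationLift₂ hS z) +
        TensorProduct.map ((gradedBialgebra k n).ydT.act (Equiv.swap i j))
          (S.mul ∘ₗ TensorProduct.mk (Polynomial k) _ _ (xT k i j)) (deformationLift₂ hS z) := by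
    intro i j z
    induction z with
    | zero => simp
    | add a b ha hb => simp only [map_add, ha, hb]; abel
    | tmul a b =>
      rw [leftMul_tmul, map_add, deformationLift₂_tmul, deformationLift₂_tmul,
        deformationLift₂_tmul, TensorProduct.map_tmul, TensorProduct.map_tmul,
        deformationLift_x_mul, deformationLift_x_mul, ydT_act_deformationLift]
      rfl
  have : S.comul.restrictScalars k ∘ₗ deformationLift hS = deformationLift₂ hS ∘ₗ comul k n :=
    LinearMap.ext_on_range span_mono fun w => by
      change S.comul (deformationLift hS (mono k w)) = deformationLift₂ hS (comul k n (mono k w))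
      induction w with
      | nil =>
        have h := hS.isBialgebra.comul_unit
        rw [deformation_unit hS.toIsDeformation] at h
        rw [mono_nil, comul_one, deformationLift₂_tmul, deformationLift_one]
        exact h
      | cons p w ih =>
        rw [mono_cons, deformationLift_x_mul, deformation_comul_xT_mul hS, ih, comul_x_mul, step]
  exact LinearMap.congr_fun this b

/-- The `k[t]`-linear extension of `deformationLift`. -/
noncomputable def deformationHom (hS : (gradedBialgebra k n).IsYDDeformation S) :
    PolyFK k n →ₗ[Polynomial k] PolyFK k n :=
  LinearMap.liftBaseChange (Polynomial k) (deformationLift hS)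

theorem deformationHom_tmul (hS : (gradedBialgebra k n).IsYDDeformation S) (p : Polynomial k)
    (b : FominKirillov k n) :
    deformationHom hS (p ⊗ₜ b) = p • deformationLift hS b := by
  simp [deformationHom]

theorem deformationHom_mem (hS : (gradedBialgebra k n).IsYDDeformation S) {d : ℕ} {z : PolyFK k n}
    (hz : z ∈ (gradedBialgebra k n).grT d) :
    deformationHom hS z ∈ (gradedBialgebra k n).grT d := by
  induction hz using AddSubgroup.closure_induction with
  | mem z h =>
    obtain ⟨i, j, h, p, hp, b, hb, rfl⟩ := h
    rw [deformationHom_tmul]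
    exact smul_mem_grT h hp (deformationLift_mem hS hb)
  | zero => rw [map_zero]; exact zero_mem _
  | add a b _ _ ha hb => rw [map_add]; exact add_mem ha hb
  | neg a _ ha => rw [map_neg]; exact neg_mem ha

theorem specializeZero_deformationHom (hS : (gradedBialgebra k n).IsYDDeformation S)
    (z : PolyFK k n) : specializeZero k _ (deformationHom hS z) = specializeZero k _ z := by
  induction z using TensorProduct.induction_on with
  | zero => simp
  | add a b ha hb => simp only [map_add, ha, hb]
  | tmul p b =>
    rw [deformationHom_tmul, specializeZero_smul, specializeZero_deformationLift,
      specializeZero_tmul]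

/-- The map is unitriangular: for `b` of degree `j`, its value at `b` is `b` plus terms `t ^ (s + 1)
c` with `c` of degree `j - (s + 1)`, and these are already reached by induction on `j`. Keeping the
preimage in the same degree also shows that the inverse is graded. -/
theorem exists_deformationHom_eq (hS : (gradedBialgebra k n).IsYDDeformation S) {d : ℕ}
    {z : PolyFK k n} (hz : z ∈ (gradedBialgebra k n).grT d) :
    ∃ y ∈ (gradedBialgebra k n).grT d, deformationHom hS y = z := by
  have key : ∀ j i, i + j = d → ∀ b ∈ gr k n j, ∃ y ∈ (gradedBialgebra k n).grT d,
      deformationHom hS y = (Polynomial.X ^ i : Polynomial k) ⊗ₜ[k] b := by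
    intro j
    induction j using Nat.strong_induction_on with
    | _ j ih =>
    intro i hij b hb
    obtain ⟨c, hc, h⟩ := exists_sum_of_mem_grT (deformationLift_mem hS hb)
    rw [Finset.sum_range_succ', pow_zero] at h
    have h0 := congrArg (specializeZero k _) h
    rw [specializeZero_deformationLift, map_add, map_sum, Finset.sum_eq_zero, zero_add,
      specializeZero_tmul, Polynomial.coeff_one_zero, one_smul] at h0
    -- Specialization has identified the constant term `c 0` with `b`.
    · rw [← h0] at h
      -- The bound `s < j` sits in the conclusion, with 0 as the default preimage, so that `choose`
      -- yields a function on all of `ℕ`.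
      have : ∀ s, ∃ y ∈ (gradedBialgebra k n).grT d, s < j →
          deformationHom hS y = (Polynomial.X ^ (i + (s + 1)) : Polynomial k) ⊗ₜ[k] c (s + 1) := by
        intro s
        by_cases hs : s < j
        · obtain ⟨y, hy, hy'⟩ := ih (j - (s + 1)) (by omega) (i + (s + 1)) (by omega) _
            (hc (s + 1) hs)
          exact ⟨y, hy, fun _ => hy'⟩
        · exact ⟨0, zero_mem _, fun h => absurd h hs⟩
      choose y hy hy' using this
      -- Subtracting preimages of the correction terms, multiplied by `t ^ i`, leaves exactly `t ^ i
      -- b`.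
      refine ⟨(Polynomial.X ^ i : Polynomial k) ⊗ₜ[k] b - ∑ s ∈ Finset.range j, y s,
        sub_mem (X_pow_tmul_mem_grT hij hb) (sum_mem fun s _ => hy s), ?_⟩
      rw [map_sub, map_sum, deformationHom_tmul, h, smul_add, Finset.smul_sum,
        Finset.sum_congr rfl fun s hs => hy' s (Finset.mem_range.1 hs)]
      simp only [TensorProduct.smul_tmul', smul_eq_mul, ← pow_add, mul_one]
      abel
    · intro s _
      rw [specializeZero_tmul, pow_succ, Polynomial.coeff_mul_X_zero, zero_smul]
  obtain ⟨c, hc, rfl⟩ := exists_sum_of_mem_grT hz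
  have : ∀ s, ∃ y ∈ (gradedBialgebra k n).grT d, s < d + 1 →
      deformationHom hS y = (Polynomial.X ^ s : Polynomial k) ⊗ₜ[k] c s := by
    intro s
    by_cases hs : s < d + 1
    · obtain ⟨y, hy, hy'⟩ := key (d - s) s (by omega) _ (hc s (by omega))
      exact ⟨y, hy, fun _ => hy'⟩
    · exact ⟨0, zero_mem _, fun h => absurd h hs⟩
  choose y hy hy' using this
  exact ⟨∑ s ∈ Finset.range (d + 1), y s, sum_mem fun s _ => hy s, by
    rw [map_sum, Finset.sum_congr rfl fun s hs => hy' s (Finset.mem_range.1 hs)]⟩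

theorem exists_sum_X_pow_tmul (z : PolyFK k n) : ∃ (N : ℕ) (c : ℕ → FominKirillov k n),
    z = ∑ s ∈ Finset.range N, (Polynomial.X ^ s : Polynomial k) ⊗ₜ[k] c s := by
  -- Prescribing the coefficients and allowing every larger length lets two expansions be added at a
  -- common length.
  suffices h : ∃ N, ∀ m ≥ N, z = ∑ s ∈ Finset.range m, (Polynomial.X ^ s : Polynomial k) ⊗ₜ[k]
      TensorProduct.lid k (FominKirillov k n)
        (LinearMap.rTensor _ (Polynomial.lcoeff k s) z) by
    obtain ⟨N, hN⟩ := h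
    exact ⟨N, _, hN N le_rfl⟩
  induction z using TensorProduct.induction_on with
  | zero => exact ⟨0, fun m _ => by simp⟩
  | add a b ha hb =>
    obtain ⟨u, hu⟩ := ha
    obtain ⟨v, hv⟩ := hb
    refine ⟨max u v, fun m hm => ?_⟩
    simp only [map_add, TensorProduct.tmul_add, Finset.sum_add_distrib]
    rw [← hu m (le_trans (le_max_left _ _) hm), ← hv m (le_trans (le_max_right _ _) hm)]
  | tmul p b =>
    refine ⟨p.natDegree + 1, fun m hm => ?_⟩
    conv_lhs => rw [p.as_sum_range' m hm, TensorProduct.sum_tmul]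
    refine Finset.sum_congr rfl fun s _ => ?_
    rw [coeff_tmul, ← TensorProduct.smul_tmul, Polynomial.smul_X_eq_monomial]

/-- Words span `FK_n[t]` over `k[t]`, and each word is homogeneous, so the graded statement applies.
-/
theorem deformationHom_surjective (hS : (gradedBialgebra k n).IsYDDeformation S) :
    Function.Surjective (deformationHom hS) := by
  intro z
  change z ∈ LinearMap.range (deformationHom hS)
  induction z using TensorProduct.induction_on with
  | zero => exact zero_mem _
  | add a b ha hb => exact add_mem ha hb
  | tmul p b =>
    have hb : b ∈ Submodule.span k (Set.range (mono k (n := n))) := by rw [span_mono]; trivial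
    have hp : p ⊗ₜ[k] b = p • ((1 : Polynomial k) ⊗ₜ[k] b) := by
      rw [TensorProduct.smul_tmul', smul_eq_mul, mul_one]
    rw [hp]
    refine Submodule.smul_mem _ _ ?_
    clear hp
    induction hb using Submodule.span_induction with
    | mem b h =>
      obtain ⟨w, rfl⟩ := h
      obtain ⟨y, -, hy⟩ := exists_deformationHom_eq hS (one_tmul_mem_grT (mono_mem_gr w))
      exact ⟨y, hy⟩
    | zero => rw [TensorProduct.tmul_zero]; exact zero_mem _
    | add a b _ _ ha hb => rw [TensorProduct.tmul_add]; exact add_mem ha hb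
    | smul r a _ ha => rw [one_tmul_smul_eq_smul]; exact Submodule.smul_mem _ _ ha

theorem X_smul_injective {k : Type*} [Field k] {n : ℕ} :
    Function.Injective fun z : PolyFK k n => (Polynomial.X : Polynomial k) • z :=
  smul_right_injective _ Polynomial.X_ne_zero

/-- The map is the identity modulo `t`, so a kernel element has zero constant term and equals `t
z'`. As `t` acts injectively over a field, `z'` is again in the kernel, with a shorter expansion. -/
theorem deformationHom_injective {k : Type*} [Field k] {n : ℕ}
    {S : BialgebraData (Polynomial k) (PolyFK k n)}
    (hS : (gradedBialgebra k n).IsYDDeformation S) :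
    Function.Injective (deformationHom hS) := by
  have key : ∀ (N : ℕ) (c : ℕ → FominKirillov k n),
      deformationHom hS (∑ s ∈ Finset.range N, (Polynomial.X ^ s : Polynomial k) ⊗ₜ[k] c s) = 0 →
      ∑ s ∈ Finset.range N, (Polynomial.X ^ s : Polynomial k) ⊗ₜ[k] c s = 0 := by
    intro N
    induction N with
    | zero => simp
    | succ N ih =>
      intro c hc
      have e : ∑ s ∈ Finset.range (N + 1), (Polynomial.X ^ s : Polynomial k) ⊗ₜ[k] c s =
          (Polynomial.X : Polynomial k) •
            ∑ s ∈ Finset.range N, (Polynomial.X ^ s : Polynomial k) ⊗ₜ[k] c (s + 1) +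
            1 ⊗ₜ c 0 := by
        rw [Finset.sum_range_succ', pow_zero, Finset.smul_sum]
        simp only [TensorProduct.smul_tmul', smul_eq_mul, pow_succ']
      -- At `t = 0` the kernel condition says that the constant coefficient `c 0` vanishes.
      have h0 := congrArg (specializeZero k _) hc
      rw [specializeZero_deformationHom, e, map_add, specializeZero_smul, specializeZero_tmul,
        Polynomial.coeff_X_zero, zero_smul, zero_add, Polynomial.coeff_one_zero, one_smul,
        map_zero] at h0
      rw [h0, TensorProduct.tmul_zero, add_zero] at e
      rw [e, map_smul] at hc
      rw [e, ih _ (X_smul_injective (hc.trans (smul_zero _).symm)), smul_zero]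
  rw [injective_iff_map_eq_zero]
  intro z hz
  obtain ⟨N, c, rfl⟩ := exists_sum_X_pow_tmul z
  exact key N c hz

theorem trivialDeformation_mul (a b : FominKirillov k n) :
    (gradedBialgebra k n).trivialDeformation.mul ((1 ⊗ₜ a) ⊗ₜ (1 ⊗ₜ b)) = 1 ⊗ₜ (a * b) := by
  change (1 * 1 : Polynomial k) ⊗ₜ (gradedBialgebra k n).data.mul (a ⊗ₜ b) = _
  rw [mul_one]
  rfl

theorem trivialDeformation_unit :
    (gradedBialgebra k n).trivialDeformation.unit 1 = 1 ⊗ₜ 1 := by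
  change (1 : Polynomial k) ⊗ₜ algebraMap k (FominKirillov k n) 1 = _
  rw [map_one]

theorem trivialDeformation_counit (a : FominKirillov k n) :
    (gradedBialgebra k n).trivialDeformation.counit (1 ⊗ₜ a) = Polynomial.C (counit k n a) := by
  change counit k n a • (1 : Polynomial k) = _
  rw [Polynomial.smul_eq_C_mul, mul_one]

theorem map_deformationHom_trivialDeformation_comul
    (hS : (gradedBialgebra k n).IsYDDeformation S) (a : FominKirillov k n) :
    TensorProduct.map (deformationHom hS) (deformationHom hS)
      ((gradedBialgebra k n).trivialDeformation.comul (1 ⊗ₜ a)) =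
      deformationLift₂ hS (comul k n a) := by
  change TensorProduct.map (deformationHom hS) (deformationHom hS)
    (TensorProduct.AlgebraTensorModule.distribBaseChange k (Polynomial k) _ _
      (1 ⊗ₜ comul k n a)) = _
  generalize comul k n a = z
  induction z with
  | zero => simp
  | add x y hx hy => simp only [TensorProduct.tmul_add, map_add, hx, hy]
  | tmul x y =>
    simp [deformationLift₂_tmul, deformationHom_tmul]

end FominKirillov

/-! ### Rigidity in the category of Yetter–Drinfeld modules -/

namespace FominKirillov

theorem linearMap_ext_one_tmul {k : Type*} [CommRing k] {n : ℕ} {N : Type*} [AddCommMonoid N]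
    [Module (Polynomial k) N] {f g : PolyFK k n →ₗ[Polynomial k] N}
    (h : ∀ b : FominKirillov k n, f (1 ⊗ₜ b) = g (1 ⊗ₜ b)) : f = g := by
  refine LinearMap.ext fun z => ?_
  induction z using TensorProduct.induction_on with
  | zero => simp
  | add a b ha hb => simp only [map_add, ha, hb]
  | tmul p b =>
    have hp : p ⊗ₜ[k] b = p • ((1 : Polynomial k) ⊗ₜ[k] b) := by
      rw [TensorProduct.smul_tmul', smul_eq_mul, mul_one]
    rw [hp, map_smul, map_smul, h]

theorem linearMap_ext_one_tmul₂ {k : Type*} [CommRing k] {n : ℕ} {N : Type*} [AddCommMonoid N]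
    [Module (Polynomial k) N] {f g : PolyFK k n ⊗[Polynomial k] PolyFK k n →ₗ[Polynomial k] N}
    (h : ∀ a b : FominKirillov k n, f ((1 ⊗ₜ a) ⊗ₜ (1 ⊗ₜ b)) = g ((1 ⊗ₜ a) ⊗ₜ (1 ⊗ₜ b))) :
    f = g :=
  TensorProduct.ext (linearMap_ext_one_tmul fun a => linearMap_ext_one_tmul fun b => h a b)

/-- The isomorphism constructed above goes from the trivial deformation to the given one. The
equivalence is its inverse, so each compatibility is proved for `e` and conjugated. -/
theorem isYDRigid (k : Type*) [Field k] (n : ℕ) : (gradedBialgebra k n).IsYDRigid := by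
  intro S hS
  let e : PolyFK k n ≃ₗ[Polynomial k] PolyFK k n :=
    LinearEquiv.ofBijective (deformationHom hS)
      ⟨deformationHom_injective hS, deformationHom_surjective hS⟩
  have he : ∀ b, e (1 ⊗ₜ b) = deformationLift hS b := fun b => by
    change deformationHom hS _ = _
    rw [deformationHom_tmul, one_smul]
  have hmul : e.toLinearMap ∘ₗ (gradedBialgebra k n).trivialDeformation.mul =
      S.mul ∘ₗ TensorProduct.map e.toLinearMap e.toLinearMap :=
    linearMap_ext_one_tmul₂ fun a b => by
      rw [LinearMap.comp_apply, LinearMap.comp_apply, trivialDeformation_mul,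
        TensorProduct.map_tmul, LinearEquiv.coe_coe, he, he, he, deformationLift_mul]
  have hcomul : TensorProduct.map e.toLinearMap e.toLinearMap ∘ₗ
      (gradedBialgebra k n).trivialDeformation.comul = S.comul ∘ₗ e.toLinearMap :=
    linearMap_ext_one_tmul fun a => by
      rw [LinearMap.comp_apply, LinearMap.comp_apply, LinearEquiv.coe_coe, he,
        comul_deformationLift]
      exact map_deformationHom_trivialDeformation_comul hS a
  have hsymm : e.symm.toLinearMap ∘ₗ e.toLinearMap = LinearMap.id := by ext; simp
  have hsymm' : e.toLinearMap ∘ₗ e.symm.toLinearMap = LinearMap.id := by ext; simp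
  have hact : ∀ g, e.toLinearMap ∘ₗ (gradedBialgebra k n).ydT.act g =
      (gradedBialgebra k n).ydT.act g ∘ₗ e.toLinearMap := fun g =>
    linearMap_ext_one_tmul fun b => by
      rw [LinearMap.comp_apply, LinearMap.comp_apply, ydT_act_tmul, LinearEquiv.coe_coe, he, he,
        ydT_act_deformationLift]
  have hproj : ∀ g, e.toLinearMap ∘ₗ (gradedBialgebra k n).ydT.proj g =
      (gradedBialgebra k n).ydT.proj g ∘ₗ e.toLinearMap := fun g =>
    linearMap_ext_one_tmul fun b => by
      rw [LinearMap.comp_apply, LinearMap.comp_apply, ydT_proj_tmul, LinearEquiv.coe_coe, he, he,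
        ydT_proj_deformationLift]
  refine ⟨e.symm, ⟨⟨?_, ?_, ?_, ?_, ?_, ?_⟩, ⟨?_, ?_⟩⟩, ?_⟩
  -- The inverse is graded because surjectivity holds degree by degree.
  · intro d z hz
    obtain ⟨y, hy, rfl⟩ := exists_deformationHom_eq hS hz
    rwa [show deformationHom hS y = e y from rfl, e.symm_apply_apply]
  · exact fun d z hz => deformationHom_mem hS hz
  · calc _ = e.symm.toLinearMap ∘ₗ (S.mul ∘ₗ TensorProduct.map e.toLinearMap e.toLinearMap) ∘ₗ
          TensorProduct.map e.symm.toLinearMap e.symm.toLinearMap := by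
          rw [LinearMap.comp_assoc, ← TensorProduct.map_comp, hsymm', TensorProduct.map_id,
            LinearMap.comp_id]
      _ = _ := by
          rw [← hmul, LinearMap.comp_assoc, ← LinearMap.comp_assoc, hsymm, LinearMap.id_comp]
  · refine LinearMap.ext_ring ?_
    rw [LinearMap.comp_apply, trivialDeformation_unit, deformation_unit hS.toIsDeformation,
      LinearEquiv.coe_coe, LinearEquiv.symm_apply_eq, he, deformationLift_one]
  · calc _ = TensorProduct.map e.symm.toLinearMap e.symm.toLinearMap ∘ₗ
          (S.comul ∘ₗ e.toLinearMap) ∘ₗ e.symm.toLinearMap := by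
          rw [LinearMap.comp_assoc, hsymm', LinearMap.comp_id]
      _ = _ := by
          rw [← hcomul, ← LinearMap.comp_assoc, ← LinearMap.comp_assoc, ← TensorProduct.map_comp,
            hsymm, TensorProduct.map_id, LinearMap.id_comp]
  · have h : S.counit ∘ₗ e.toLinearMap = (gradedBialgebra k n).trivialDeformation.counit :=
      linearMap_ext_one_tmul fun b => by
        rw [LinearMap.comp_apply, LinearEquiv.coe_coe, he, counit_deformationLift,
          trivialDeformation_counit]
    rw [← h, LinearMap.comp_assoc, hsymm', LinearMap.comp_id]
  · intro g
    calc _ = e.symm.toLinearMap ∘ₗ ((gradedBialgebra k n).ydT.act g ∘ₗ e.toLinearMap) ∘ₗ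
          e.symm.toLinearMap := by rw [LinearMap.comp_assoc, hsymm', LinearMap.comp_id]
      _ = _ := by
          rw [← hact, LinearMap.comp_assoc, ← LinearMap.comp_assoc, hsymm, LinearMap.id_comp]
  · intro g
    calc _ = e.symm.toLinearMap ∘ₗ ((gradedBialgebra k n).ydT.proj g ∘ₗ e.toLinearMap) ∘ₗ
          e.symm.toLinearMap := by rw [LinearMap.comp_assoc, hsymm', LinearMap.comp_id]
      _ = _ := by
          rw [← hproj, LinearMap.comp_assoc, ← LinearMap.comp_assoc, hsymm, LinearMap.id_comp]
  · intro b
    rw [← specializeZero_deformationHom hS, show deformationHom hS (e.symm (1 ⊗ₜ b)) =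
      1 ⊗ₜ b from e.apply_symm_apply _, specializeZero_tmul, Polynomial.coeff_one_zero, one_smul]

end FominKirillov

/-! ### From commuting with the braiding to morphisms of Yetter–Drinfeld modules -/

namespace FominKirillov

variable {k : Type*} [CommRing k] {n : ℕ}

/-- The algebra homomorphism to the
square-zero extension with `x_(ij) ↦ e_(ij) - e_(ji)`. -/
noncomputable def toTrivSqZeroExt (k : Type*) [CommRing k] (n : ℕ) :
    FominKirillov k n →ₐ[k] TrivSqZeroExt k (Fin n × Fin n → k) :=
  lift (fun i j => TrivSqZeroExt.inr (Pi.single (i, j) 1 - Pi.single (j, i) 1))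
    { self := fun i => by simp
      anti := fun i j => by rw [← TrivSqZeroExt.inr_neg, neg_sub]
      sq := fun i j _ => TrivSqZeroExt.inr_mul_inr _ _ _
      cyc := fun i j l _ _ _ => by simp only [TrivSqZeroExt.inr_mul_inr, add_zero]
      comm := fun i j l m _ _ _ _ _ _ => by simp only [TrivSqZeroExt.inr_mul_inr] }

theorem snd_toTrivSqZeroExt_x (i j : Fin n) :
    (toTrivSqZeroExt k n (x k i j)).snd = Pi.single (i, j) 1 - Pi.single (j, i) 1 := by
  rw [toTrivSqZeroExt, lift_x, TrivSqZeroExt.snd_inr]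

/-- All relations are quadratic, so they hold trivially in a square-zero extension, where the
generators stay visible as the vectors `e_(ij) - e_(ji)`. -/
theorem x_ne_zero [Nontrivial k] {i j : Fin n} (hij : i ≠ j) : x k i j ≠ 0 := by
  intro h
  have := congrArg (fun z => (toTrivSqZeroExt k n z).snd (i, j)) h
  simp [snd_toTrivSqZeroExt_x, hij] at this

/-- Comparing coordinates at `(a, b)` leaves `x_(ab) = x_(cd)` or `x_(ab) = x_(dc) = - x_(cd)`; the
latter would give `1 = -1`, which `2 ≠ 0` excludes. -/
theorem eq_and_eq_of_x_eq (h2 : (2 : k) ≠ 0) {a b c d : Fin n} (hab : a ≠ b)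
    (h : x k a b = x k c d) : a = c ∧ b = d := by
  have h1 : (1 : k) ≠ 0 := fun h => h2 (by rw [← one_add_one_eq_two, h, add_zero])
  have := congrArg (fun z => (toTrivSqZeroExt k n z).snd (a, b)) h
  simp only [snd_toTrivSqZeroExt_x, Pi.sub_apply, Pi.single_apply, Prod.mk.injEq, hab, hab.symm,
    and_self, if_true, if_false, sub_zero] at this
  by_contra hne
  rw [if_neg hne] at this
  split_ifs at this
  · exact h2 (by rw [← one_add_one_eq_two]; nth_rw 1 [this]; simp)
  · exact h1 (by simpa using this)

theorem xT_ne_zero [Nontrivial k] {i j : Fin n} (hij : i ≠ j) : xT k i j ≠ 0 := by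
  intro h
  have := congrArg (specializeZero k _) h
  rw [specializeZero_tmul, Polynomial.coeff_one_zero, one_smul, map_zero] at this
  exact x_ne_zero hij this

/-- For any `j ≠ i`, the element `g · x_(ij) = x_(g(i) g(j))` determines `g(i)` as its first index.
-/
theorem ydT_act_injective (h2 : (2 : k) ≠ 0) (hn : 2 ≤ n) :
    Function.Injective (gradedBialgebra k n).ydT.act := by
  intro g h hgh
  refine Equiv.ext fun i => ?_
  have : Nontrivial (Fin n) := Fin.nontrivial_iff_two_le.2 hn
  obtain ⟨j, hj⟩ := exists_ne i
  have e := congrArg (specializeZero k _) (LinearMap.congr_fun hgh (xT k i j))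
  rw [ydT_act_tmul, ydT_act_tmul, specializeZero_tmul, specializeZero_tmul,
    Polynomial.coeff_one_zero, one_smul, one_smul, act_x, act_x] at e
  exact (eq_and_eq_of_x_eq h2 (by simpa using hj.symm) e).1

/-- The first identity recovers the coaction, because the action on `FK_n[t]` is faithful. The
second recovers the action of each transposition `(ij)`, because `x_(ij)` is a nonzero element of
that degree, and transpositions generate `S_n`. -/
theorem isHom_of_commutes {k : Type*} [Field k] (h2 : (2 : k) ≠ 0) {n : ℕ} (hn : 2 ≤ n)
    {M N : Type*} [AddCommGroup M] [Module (Polynomial k) M] [AddCommGroup N]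
    [Module (Polynomial k) N] [Module.Free (Polynomial k) N]
    {Y : YetterDrinfeld (Polynomial k) (Equiv.Perm (Fin n)) M}
    {Z : YetterDrinfeld (Polynomial k) (Equiv.Perm (Fin n)) N} {f : M →ₗ[Polynomial k] N}
    (hl : Z.braiding (gradedBialgebra k n).ydT ∘ₗ LinearMap.rTensor _ f =
      LinearMap.lTensor _ f ∘ₗ Y.braiding (gradedBialgebra k n).ydT)
    (hr : (gradedBialgebra k n).ydT.braiding Z ∘ₗ LinearMap.lTensor _ f =
      LinearMap.rTensor _ f ∘ₗ (gradedBialgebra k n).ydT.braiding Y) : Y.IsHom Z f where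
  proj := YetterDrinfeld.comp_proj_of_braiding_left (ydT_act_injective h2 hn) hl
  act g := by
    induction g using Equiv.Perm.swap_induction_on with
    | one => rw [map_one, map_one]; rfl
    | swap_mul g i j hij ih =>
      have := YetterDrinfeld.comp_act_of_braiding_right hr (ydT_proj_xT i j) (xT_ne_zero hij)
      rw [map_mul, map_mul, Module.End.mul_eq_comp, Module.End.mul_eq_comp, ← LinearMap.comp_assoc,
        this, LinearMap.comp_assoc, ih, LinearMap.comp_assoc]

/-- Once the induced braidings are identified with those of the tensor square and of the unit
object, each structure map is an instance of `isHom_of_commutes`. -/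
theorem isYetterDrinfeld_of_commutesWith {k : Type*} [Field k] (h2 : (2 : k) ≠ 0) {n : ℕ}
    (hn : 2 ≤ n) {S : BialgebraData (Polynomial k) (PolyFK k n)}
    (hS : S.CommutesWith (gradedBialgebra k n).braidingT) :
    S.IsYetterDrinfeld (gradedBialgebra k n).ydT where
  mul := isHom_of_commutes h2 hn
    (by rw [← YetterDrinfeld.braidingLeft_braiding]; exact hS.mul_left)
    (by rw [← YetterDrinfeld.braidingRight_braiding]; exact hS.mul_right)
  unit := isHom_of_commutes h2 hn
    (by rw [YetterDrinfeld.unit_braiding]; exact hS.unit_left)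
    (by rw [YetterDrinfeld.braiding_unit]; exact hS.unit_right)
  comul := isHom_of_commutes h2 hn
    (by rw [← YetterDrinfeld.braidingLeft_braiding]; exact hS.comul_left)
    (by rw [← YetterDrinfeld.braidingRight_braiding]; exact hS.comul_right)
  counit := isHom_of_commutes h2 hn
    (by rw [YetterDrinfeld.unit_braiding]; exact hS.counit_left)
    (by rw [YetterDrinfeld.braiding_unit]; exact hS.counit_right)

/-- A braided deformation is a Yetter–Drinfeld deformation, and the equivalence obtained there
commutes with the braiding by naturality. -/
theorem isBraidedRigid (k : Type*) [Field k] (h2 : (2 : k) ≠ 0) (n : ℕ) (hn : 2 ≤ n) :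
    (gradedBialgebra k n).IsBraidedRigid := by
  intro S hS
  obtain ⟨f, hf, hf0⟩ := isYDRigid k n S
    ⟨hS.toIsDeformation, isYetterDrinfeld_of_commutesWith h2 hn hS.commutesWith⟩
  exact ⟨f, ⟨hf.toIsGradedBialgebraIso, hf.isHom.braiding_left _, hf.isHom.braiding_right _⟩, hf0⟩

end FominKirillov

/-- The Fomin-Kirillov algebra `FK_n`, `n ≥ 3`, admits no nontrivial graded deformations, neither
in the category of Yetter-Drinfeld modules over `S_n` nor as a braided bialgebra. -/
theorem mainTheorem8 (k : Type*) [Field k] [CharZero k] (n : ℕ) (hn : 3 ≤ n) :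
    (FominKirillov.gradedBialgebra k n).IsYDRigid ∧
      (FominKirillov.gradedBialgebra k n).IsBraidedRigid :=
  ⟨FominKirillov.isYDRigid k n,
    FominKirillov.isBraidedRigid k two_ne_zero n (by omega)⟩
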